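/- Let $n,T\ge 1$, let $g^*(k)\in\mathbb C^n$ ($k=1,\dots,T$) have entries of modulus one, and suppose $\sum_{k=1}^{T-1}\|g^*(k)-g^*(k+1)\|_2^2\le S_T$. Let $\overline G^*\in\mathbb C^{nT\times n}$ be the matrix obtained by stacking the blocks $g^*(k)g^*(k)^{\mathsf H}-I_n$. Let $\eta\in[0,1]$ and $p(1),\dots,p(T)\in[0,1]$. (Outliers model.) Let $\mathcal H_k\sim ER(n,p(k))$, $k=1,\dots,T$, be independent Erdős–Rényi graphs on $\{1,\dots,n\}$. For $i<j$ put $A_{ij}(k)=0$ if $\{i,j\}$ is not an edge of $\mathcal H_k$; if it is an edge, then $A_{ij}(k)=g_i^*(k)\overline{g_j^*(k)}$ with probability $1-\eta$ and $A_{ij}(k)=e^{\iota\varphi_{ij}(k)}$ with probability $\eta$, where $\varphi_{ij}(k)\sim\mathrm{Unif}[0,2\pi)$; all choices over pairs $i<j$ and times $k$ are independent. Put $A_{ii}(k)=0$, $A_{ji}(k)=\overline{A_{ij}(k)}$, and let $A\in\mathbb C^{nT\times n}$ be the stack of $A(1),\dots,A(T)$. Let $v_1,\dots,v_T$ be real orthonormal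 eigenvectors of the Laplacian of the path graph on $T$ vertices, with eigenvalues $\lambda_1\ge\dots\ge\lambda_T$, and for $1\le\tau\le T$ let $\mathcal P_{\tau,n}=\big(\sum_{k=0}^{\tau-1}v_{T-k}v_{T-k}^\top\big)\otimes I_n$ and $\mathcal P^\perp_{\tau,n}=I_{nT}-\mathcal P_{\tau,n}$. Let $d(k)=(1-\eta)p(k)$, $D=\mathrm{blkdiag}(d(1)I_n,\dots,d(T)I_n)$, $\bar d=\frac1T\sum_{k=1}^T d(k)$, and assume that $D$ is $\mu$-smooth for some $\mu\ge1$: $$\|\mathcal P^\perp_{\tau,n}(D\overline G^*)\|_F^2\le\mu\bar d^2\|\mathcal P^\perp_{\tau,n}\overline G^*\|_F^2\qquad\text{for all }\tau\in\{1,\dots,T\}.$$ For $x\in[0,1]$ let $Q(x)=\|X\|_{\psi_2}=\sup_{q\ge1}q^{-1/2}(\mathbb E|X|^q)^{1/q}$, where $X$ is a centered Bernoulli variable with parameter $x$, and define $$p_{\max}=\max_kp(k),\quad V=\max_kp(k)(1-p(k)),\quad Q=\eta+Q(\eta)+\max_kQ(p(k)),$$ $$f=p_{\max}\eta+(1-\eta)^2V+p_{\max}V(1-\eta),\qquad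 \tilde f=f+Q^2\log(1/\delta),\qquad \rho=\frac{\mu\bar d^2T^2S_T}{n\tilde f}.$$ Then there are universal constants $C_1\in(0,1)$ and $C_2,C_3,C_4,C_5>0$ such that in every such setting and for every $\delta\in(0,C_1)$ the following holds for $\hat G=\mathcal P_{\tau^*,n}A$ with $$\tau^*=\min\{1+\lfloor\rho^{1/3}\rfloor,\,T\}$$ (when $\tilde f=0$, $\rho$ is read as $+\infty$, so that $\tau^*=T$, and the right-hand side of (a) is read as $0$). 1. With probability at least $1-\delta$, $$\|\hat G-D\overline G^*\|_F^2\le C_2\max\Big\{\frac{\mu\bar d^2nT^2S_T}{1+\rho^{2/3}},\ \mu\bar d^2nS_T\Big\}\mathbf 1_{\tau^*<T}+C_3\,\tilde f\,n^2\min\{1+\rho^{1/3},\,T\}.\tag{a}$$ 2. Suppose moreover that $\tilde f,\bar d,S_T>0$ and $$T\ge C_4\max\Big\{\Big(\frac{n\tilde f}{\mu\bar d^2S_T}\Big)^{1/2},\ \frac{\mu\bar d^2S_T}{n\tilde f}\Big\}.$$ Then (a) implies $$\|\hat G-D\overline G^*\|_F^2\le C_5\,\tilde f^{2/3}(\mu\bar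 d^2)^{1/3}n^{5/3}T^{2/3}S_T^{1/3},$$ and in particular this bound holds with probability at least $1-\delta$. -/

import Mathlib

open MeasureTheory ProbabilityTheory
open scoped unitInterval

namespace DynSync

noncomputable section

/-! ### Stacked matrices

A stacked matrix `concat(X(1), …, X(T)) ∈ ℂ^{nT × n}` has rows indexed by `(k, i) : Fin T × Fin n`. -/

/-- The squared Frobenius norm. -/
def frobSq {m n : Type*} [Fintype m] [Fintype n] (X : Matrix m n ℂ) : ℝ :=
  ∑ i, ∑ j, ‖X i j‖ ^ 2

/-- The block `g(k) g(k)ᴴ - I_n`. -/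
def GbarBlock {n T : ℕ} (g : Fin T → Fin n → ℂ) (k : Fin T) : Matrix (Fin n) (Fin n) ℂ :=
  Matrix.vecMulVec (g k) (star (g k)) - 1

/-- The stacked matrix with blocks `g(k) g(k)ᴴ - I_n`. -/
def Gbar {n T : ℕ} (g : Fin T → Fin n → ℂ) : Matrix (Fin T × Fin n) (Fin n) ℂ :=
  Matrix.of fun r j => GbarBlock g r.1 r.2 j

/-- `d(k) = (1 - η) p(k)`. -/
def dCoef {T : ℕ} (η : I) (p : Fin T → I) (k : Fin T) : ℝ := (1 - (η : ℝ)) * (p k : ℝ)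

/-- `blkdiag (d(1) I_n, …, d(T) I_n)`. -/
def Dmat (n : ℕ) {T : ℕ} (η : I) (p : Fin T → I) :
    Matrix (Fin T × Fin n) (Fin T × Fin n) ℂ :=
  Matrix.diagonal fun r => (dCoef η p r.1 : ℂ)

/-- The average of `d(1), …, d(T)`. -/
def dBar {T : ℕ} (η : I) (p : Fin T → I) : ℝ := (∑ k, dCoef η p k) / T

/-! ### Low-frequency projection -/

/-- The Laplacian of the path graph on `T` vertices. -/
def pathLaplacian (T : ℕ) : Matrix (Fin T) (Fin T) ℝ :=
  letI := Classical.decRel (SimpleGraph.pathGraph T).Adj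
  (SimpleGraph.pathGraph T).lapMatrix ℝ

/-- `v` is an orthonormal basis of eigenvectors of the path Laplacian, ordered so that the
corresponding eigenvalues `lam` are non-increasing. -/
structure IsSortedEigenbasis {T : ℕ} (lam : Fin T → ℝ)
    (v : OrthonormalBasis (Fin T) ℝ (EuclideanSpace ℝ (Fin T))) : Prop where
  antitone : Antitone lam
  eigen : ∀ k, (pathLaplacian T).mulVec (v k).ofLp = lam k • (v k).ofLp

/-- `∑ v_k v_kᵀ` over the last `τ` indices, i.e. over eigenvectors of the `τ` smallest eigenvalues. -/
def lowFreq {T : ℕ} (v : OrthonormalBasis (Fin T) ℝ (EuclideanSpace ℝ (Fin T))) (τ : ℕ) :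
    Matrix (Fin T) (Fin T) ℝ :=
  ∑ k ∈ Finset.univ.filter (fun k : Fin T => T ≤ (k : ℕ) + τ), Matrix.vecMulVec (v k).ofLp (v k).ofLp

/-- The projection `(∑ v_k v_kᵀ) ⊗ I_n`, the sum being over the `τ` smallest eigenvalues. -/
def proj {T : ℕ} (v : OrthonormalBasis (Fin T) ℝ (EuclideanSpace ℝ (Fin T))) (τ n : ℕ) :
    Matrix (Fin T × Fin n) (Fin T × Fin n) ℂ :=
  Matrix.kronecker ((lowFreq v τ).map Complex.ofReal) (1 : Matrix (Fin n) (Fin n) ℂ)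

/-! ### Smoothness assumptions -/

/-- `∑_{k=1}^{T-1} ‖g(k) - g(k+1)‖₂² ≤ S`. -/
def SignalSmooth {n T : ℕ} (g : Fin T → Fin n → ℂ) (S : ℝ) : Prop :=
  ∑ k : Fin (T - 1), ∑ i : Fin n,
    ‖g ⟨k, by omega⟩ i - g ⟨k + 1, by omega⟩ i‖ ^ 2 ≤ S

/-- The matrix `D` is `μ`-smooth. -/
def DSmooth {n T : ℕ} (v : OrthonormalBasis (Fin T) ℝ (EuclideanSpace ℝ (Fin T)))
    (g : Fin T → Fin n → ℂ) (η : I) (p : Fin T → I) (μ : ℝ) : Prop :=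
  ∀ τ : ℕ, 1 ≤ τ → τ ≤ T →
    frobSq ((1 - proj v τ n) * (Dmat n η p * Gbar g)) ≤
      μ * dBar η p ^ 2 * frobSq ((1 - proj v τ n) * Gbar g)

/-! ### The Outliers model -/

/-- Index of the unordered pair `{i, j}`, written with `i < j`, at time `k`. -/
abbrev PairIdx (n T : ℕ) : Type := Fin T × {q : Fin n × Fin n // q.1 < q.2}

/-- The uniform distribution on `[0, 2π)`. -/
def unifAngle : Measure ℝ := cond volume (Set.Ico 0 (2 * Real.pi))

/-- The random ingredients of the Outliers model. For every time `k` and every pair `i < j`,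
independently over all times and pairs: `{i, j}` is an edge of the graph `H k` with probability
`p k` (so the `H k` are independent Erdős–Rényi graphs), and, independently of this, its measurement
is an outlier with probability `η`, and an independent angle is drawn uniformly from `[0, 2π)`. -/
structure IsOutliersModel {Ω : Type*} [MeasurableSpace Ω] (P : Measure Ω) {n T : ℕ}
    (η : I) (p : Fin T → I) (H : Fin T → Ω → SimpleGraph (Fin n))
    (outlier : PairIdx n T → Ω → Prop) (φ : PairIdx n T → Ω → ℝ) : Prop where
  measurable_adj : ∀ e : PairIdx n T, Measurable fun ω => (H e.1 ω).Adj e.2.1.1 e.2.1.2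
  measurable_outlier : ∀ e, Measurable (outlier e)
  measurable_angle : ∀ e, Measurable (φ e)
  indep : iIndepFun
    (fun (e : PairIdx n T) ω => ((H e.1 ω).Adj e.2.1.1 e.2.1.2, outlier e ω, φ e ω)) P
  law : ∀ e : PairIdx n T,
    P.map (fun ω => ((H e.1 ω).Adj e.2.1.1 e.2.1.2, outlier e ω, φ e ω)) =
      (bernoulliMeasure True False (p e.1)).prod
        ((bernoulliMeasure True False η).prod unifAngle)

open Classical in
/-- The measurement for a pair `i < j` at time `k`: pure noise `exp(ι φ)` for an outlier edge,
`g_i conj(g_j)` for any other edge, and `0` for a non-edge. -/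
def pairObs {Ω : Type*} {n T : ℕ} (g : Fin T → Fin n → ℂ)
    (H : Fin T → Ω → SimpleGraph (Fin n)) (outlier : PairIdx n T → Ω → Prop)
    (φ : PairIdx n T → Ω → ℝ) (e : PairIdx n T) (ω : Ω) : ℂ :=
  if (H e.1 ω).Adj e.2.1.1 e.2.1.2 then
    if outlier e ω then Complex.exp (Complex.I * (φ e ω : ℂ))
    else g e.1 e.2.1.1 * star (g e.1 e.2.1.2)
  else 0

/-- The stacked measurement matrix: each block is Hermitian with zero diagonal. -/
def obs {Ω : Type*} {n T : ℕ} (g : Fin T → Fin n → ℂ)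
    (H : Fin T → Ω → SimpleGraph (Fin n)) (outlier : PairIdx n T → Ω → Prop)
    (φ : PairIdx n T → Ω → ℝ) (ω : Ω) : Matrix (Fin T × Fin n) (Fin n) ℂ :=
  Matrix.of fun r j =>
    if h : r.2 < j then pairObs g H outlier φ (r.1, ⟨(r.2, j), h⟩) ω
    else if h : j < r.2 then star (pairObs g H outlier φ (r.1, ⟨(j, r.2), h⟩) ω)
    else 0

/-! ### Quantities in the bound -/

/-- The subgaussian norm `sup_{q ≥ 1} q^{-1/2} (E |X|^q)^{1/q}`. -/
def psi2Norm {Ω : Type*} [MeasurableSpace Ω] (P : Measure Ω) (X : Ω → ℝ) : ℝ :=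
  ⨆ q : Set.Ici (1 : ℝ), (q : ℝ) ^ (-(1 / 2) : ℝ) * (∫ ω, |X ω| ^ (q : ℝ) ∂P) ^ (1 / (q : ℝ))

/-- The subgaussian norm of a centered Bernoulli variable, which takes the value `1 - x` with
probability `x` and `-x` with probability `1 - x`. -/
def Qber (x : I) : ℝ :=
  psi2Norm (bernoulliMeasure (1 - (x : ℝ)) (-(x : ℝ)) x) id

/-- The maximum of the `p(k)`. -/
def pMax {T : ℕ} (p : Fin T → I) : ℝ := ⨆ k, (p k : ℝ)

/-- The maximum of the `p(k) (1 - p(k))`. -/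
def Vmax {T : ℕ} (p : Fin T → I) : ℝ := ⨆ k, (p k : ℝ) * (1 - (p k : ℝ))

/-- `Q = η + Q(η) + max_k Q(p(k))`. -/
def Qtot {T : ℕ} (η : I) (p : Fin T → I) : ℝ := (η : ℝ) + Qber η + ⨆ k, Qber (p k)

/-- `f = p_max η + (1 - η)² V + p_max V (1 - η)`. -/
def fVar {T : ℕ} (η : I) (p : Fin T → I) : ℝ :=
  pMax p * η + (1 - (η : ℝ)) ^ 2 * Vmax p + pMax p * Vmax p * (1 - (η : ℝ))

/-- `f + Q² log (1/δ)`. -/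
def fTilde {T : ℕ} (η : I) (p : Fin T → I) (δ : ℝ) : ℝ :=
  fVar η p + Qtot η p ^ 2 * Real.log (1 / δ)

/-- The ratio `μ d̄² T² S / (n f̃)`. -/
def ratio (n : ℕ) {T : ℕ} (η : I) (p : Fin T → I) (μ S δ : ℝ) : ℝ :=
  μ * dBar η p ^ 2 * (T : ℝ) ^ 2 * S / (n * fTilde η p δ)

/-- The parameter `τ* = min {1 + ⌊(μ d̄² T² S / (n f̃))^{1/3}⌋, T}`. If `f̃ = 0` (no randomness at
all) the ratio is read as `+∞`, so that `τ* = T`. -/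
def tauStar (n : ℕ) {T : ℕ} (η : I) (p : Fin T → I) (μ S δ : ℝ) : ℕ :=
  if fTilde η p δ = 0 then T
  else min (1 + ⌊(ratio n η p μ S δ) ^ (1 / 3 : ℝ)⌋₊) T

/-- The squared error `‖P_{τ*,n} A - D Ḡ‖_F²` of the denoised matrix. -/
def sqError {Ω : Type*} {n T : ℕ} (v : OrthonormalBasis (Fin T) ℝ (EuclideanSpace ℝ (Fin T)))
    (g : Fin T → Fin n → ℂ) (η : I) (p : Fin T → I) (μ S δ : ℝ)
    (H : Fin T → Ω → SimpleGraph (Fin n)) (outlier : PairIdx n T → Ω → Prop)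
    (φ : PairIdx n T → Ω → ℝ) (ω : Ω) : ℝ :=
  frobSq (proj v (tauStar n η p μ S δ) n * obs g H outlier φ ω - Dmat n η p * Gbar g)

/-- Right-hand side of the general bound. -/
def generalBound (C₂ C₃ : ℝ) (n : ℕ) {T : ℕ} (η : I) (p : Fin T → I) (μ S δ : ℝ) : ℝ :=
  (if tauStar n η p μ S δ < T then
    C₂ * max (μ * dBar η p ^ 2 * n * (T : ℝ) ^ 2 * S / (1 + (ratio n η p μ S δ) ^ (2 / 3 : ℝ)))
      (μ * dBar η p ^ 2 * n * S)
  else 0) +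
  C₃ * fTilde η p δ * (n : ℝ) ^ 2 * min (1 + (ratio n η p μ S δ) ^ (1 / 3 : ℝ)) T

/-- Right-hand side of the simplified bound. -/
def simpleBound (C₅ : ℝ) (n : ℕ) {T : ℕ} (η : I) (p : Fin T → I) (μ S δ : ℝ) : ℝ :=
  C₅ * fTilde η p δ ^ (2 / 3 : ℝ) * (μ * dBar η p ^ 2) ^ (1 / 3 : ℝ) * (n : ℝ) ^ (5 / 3 : ℝ) *
    (T : ℝ) ^ (2 / 3 : ℝ) * S ^ (1 / 3 : ℝ)

end

end DynSync

open scoped NNReal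

namespace DynSync

/-! ### Sub-Gaussian variables -/

/-! The time projection acts on every entry sequence k ↦ X(k)_{ij} separately. In the eigenbasis of
the path Laplacian the squared error therefore splits without cross terms (`frobSq_proj_mul_sub`):
the high-frequency coefficients of D Ḡ form a deterministic bias, and the low-frequency coefficients
of A - D Ḡ form the noise. The noise is centred because outliers average to zero over the circle and
the diagonal of Ḡ vanishes.

Bias: a squared coefficient costs energy λ, and λ ≥ τ²/(4T²) beyond the τ lowest frequencies
(`eigenvalue_ge`). That bound needs no explicit eigenvectors, only a Courant–Fischer dimension count
and a blockwise Poincaré inequality. With μ-smoothness of D the bias is at most of order μ d̄² n T²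
S / τ² (`bias_le`).

Noise: the moments of a centred measurement are governed by Q
(`integral_norm_measurement_sub_pow_le`), so its real and imaginary parts are sub-Gaussian with
variance proxy of order Q². A combination over independent times with unit coefficient vector keeps
this proxy. At most 2n²τ real coefficients occur. Jensen and Markov for the average of the
exponentials of their squares (`measureReal_sum_sq_gt_le`) bound the noise by order n² τ Q²
log(1/δ), with no independence between coefficients. The summand f of f̃ is pure slack here.

Balancing T²/τ² against τ gives τ of order ρ^{1/3}, which is τ*. The second assertion is
deterministic: the condition on T places ρ^{1/3} in [1, T], where both terms are at most of order f̃
n² ρ^{1/3}. -/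

lemma natCast_pow_self_le (m : ℕ) : (m : ℝ) ^ m ≤ Real.exp 1 ^ m * (m.factorial : ℝ) := by
  -- m^m / m! is one term of the exponential series of e^m.
  have h := Real.pow_div_factorial_le_exp (m : ℝ) (Nat.cast_nonneg m) m
  rw [div_le_iff₀ (by positivity)] at h
  rwa [← Real.exp_one_pow m] at h

/-- The linear term is kept exact so that it disappears on integrating a centred variable, leaving
only a quadratic exponential moment. -/
lemma exp_le_add_exp_sq (x : ℝ) : Real.exp x ≤ x + Real.exp (x ^ 2) := by
  have h2 := Real.add_one_le_exp (x ^ 2)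
  rcases le_total |x| 1 with h | h
  · have := (abs_le.1 (Real.abs_exp_sub_one_sub_id_le h)).2
    linarith
  · rcases le_abs.1 h with h1 | h1
    · have : Real.exp x ≤ Real.exp (x ^ 2) := Real.exp_le_exp.2 (by nlinarith)
      linarith
    · have : Real.exp x ≤ 1 := Real.exp_le_one_iff.2 (by linarith)
      nlinarith

section Moments

variable {Ω : Type*} [MeasurableSpace Ω] {P : Measure Ω} [IsProbabilityMeasure P] {X : Ω → ℝ}
  {B K : ℝ}

lemma integrable_of_abs_le {Y : Ω → ℝ} (hY : Measurable Y) (C : ℝ) (h : ∀ ω, |Y ω| ≤ C) :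
    Integrable Y P :=
  Integrable.of_bound hY.aestronglyMeasurable C (Filter.Eventually.of_forall h)

lemma integrable_exp_mul_sq (hX : Measurable X) (hB : ∀ ω, |X ω| ≤ B) (s : ℝ) :
    Integrable (fun ω => Real.exp (s * X ω ^ 2)) P := by
  refine integrable_of_abs_le (by fun_prop) (Real.exp (|s| * B ^ 2)) fun ω => ?_
  rw [Real.abs_exp, Real.exp_le_exp]
  have h1 : X ω ^ 2 ≤ B ^ 2 := sq_le_sq' (by linarith [(abs_le.1 (hB ω)).1]) (abs_le.1 (hB ω)).2
  have := le_abs_self s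
  have := abs_nonneg s
  nlinarith [sq_nonneg (X ω)]

lemma integrable_exp_mul_of_abs_le (hX : Measurable X) (hB : ∀ ω, |X ω| ≤ B) (t : ℝ) :
    Integrable (fun ω => Real.exp (t * X ω)) P := by
  refine integrable_of_abs_le (by fun_prop) (Real.exp (|t| * B)) fun ω => ?_
  rw [Real.abs_exp, Real.exp_le_exp]
  calc t * X ω ≤ |t * X ω| := le_abs_self _
    _ = |t| * |X ω| := abs_mul _ _
    _ ≤ |t| * B := mul_le_mul_of_nonneg_left (hB ω) (abs_nonneg t)

lemma integrable_pow_of_abs_le (hX : Measurable X) (hB : ∀ ω, |X ω| ≤ B) (m : ℕ) :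
    Integrable (fun ω => X ω ^ m) P :=
  integrable_of_abs_le (by fun_prop) (B ^ m) fun ω => by
    rw [abs_pow]; exact pow_le_pow_left₀ (abs_nonneg _) (hB ω) m

/-- Moment growth `E X^{2m} ≤ (K m)^m` controls the exponential moments of `X²`. -/
lemma integral_exp_mul_sq_le (hX : Measurable X) (hB : ∀ ω, |X ω| ≤ B) (hK : 0 ≤ K)
    (hmom : ∀ m : ℕ, ∫ ω, X ω ^ (2 * m) ∂P ≤ (K * m) ^ m) {s : ℝ} (hs : 0 ≤ s)
    (hsK : s * K * Real.exp 1 ≤ 1 / 2) :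
    ∫ ω, Real.exp (s * X ω ^ 2) ∂P ≤ 1 + 2 * (s * K * Real.exp 1) := by
  set y := s * K * Real.exp 1 with hy
  have hy0 : 0 ≤ y := by positivity
  -- Terms of the exponential series. The moment bound and m^m ≤ e^m m! make their integrals at most
  -- y^m, a geometric series with ratio at most 1/2.
  let F : ℕ → Ω → ℝ := fun m ω => (s * X ω ^ 2) ^ m / (m.factorial : ℝ)
  have hF0 : ∀ m ω, 0 ≤ F m ω := fun m ω => by positivity
  have hFeq : ∀ m, F m = fun ω => s ^ m / (m.factorial : ℝ) * X ω ^ (2 * m) := by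
    intro m; ext ω; simp only [F]; rw [mul_pow, ← pow_mul]; ring
  have hFint : ∀ m, Integrable (F m) P := fun m => by
    rw [hFeq]; exact (integrable_pow_of_abs_le hX hB _).const_mul _
  have hFle : ∀ m, ∫ ω, F m ω ∂P ≤ y ^ m := by
    intro m
    rw [hFeq, integral_const_mul]
    have hf : (0 : ℝ) < m.factorial := by positivity
    calc s ^ m / (m.factorial : ℝ) * ∫ ω, X ω ^ (2 * m) ∂P
        ≤ s ^ m / (m.factorial : ℝ) * (K * m) ^ m := by gcongr; exact hmom m
      _ = s ^ m * K ^ m / (m.factorial : ℝ) * (m : ℝ) ^ m := by rw [mul_pow]; ring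
      _ ≤ s ^ m * K ^ m / (m.factorial : ℝ) * (Real.exp 1 ^ m * (m.factorial : ℝ)) := by
          gcongr; exact natCast_pow_self_le m
      _ = y ^ m := by rw [hy, mul_pow, mul_pow]; field_simp
  have hgeo : Summable fun m : ℕ => y ^ m := summable_geometric_of_lt_one hy0 (by linarith)
  have hnorm : ∀ m, ∫ ω, ‖F m ω‖ ∂P = ∫ ω, F m ω ∂P := fun m =>
    integral_congr_ae (Filter.Eventually.of_forall fun ω => Real.norm_of_nonneg (hF0 m ω))
  have hsum : Summable fun m => ∫ ω, F m ω ∂P :=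
    Summable.of_nonneg_of_le (fun m => integral_nonneg (hF0 m)) hFle hgeo
  have key := integral_tsum_of_summable_integral_norm hFint (by simpa only [hnorm] using hsum)
  have hexp : ∀ ω, ∑' m, F m ω = Real.exp (s * X ω ^ 2) := fun ω => by
    rw [Real.exp_eq_exp_ℝ, NormedSpace.exp_eq_tsum_div]
  simp only [hexp] at key
  rw [← key]
  calc ∑' m, ∫ ω, F m ω ∂P ≤ ∑' m : ℕ, y ^ m := hsum.tsum_le_tsum hFle hgeo
    _ = (1 - y)⁻¹ := tsum_geometric_of_lt_one hy0 (by linarith)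
    _ ≤ 1 + 2 * y := by
        rw [inv_le_iff_one_le_mul₀ (by linarith)]; nlinarith

/-- A bounded centred variable with `E X^{2m} ≤ (K m)^m` is sub-Gaussian. -/
lemma hasSubgaussianMGF_of_moments (hX : Measurable X) (hB : ∀ ω, |X ω| ≤ B) (hK : 0 < K)
    (hmean : ∫ ω, X ω ∂P = 0) (hmom : ∀ m : ℕ, ∫ ω, X ω ^ (2 * m) ∂P ≤ (K * m) ^ m) :
    HasSubgaussianMGF X (5 * K * Real.exp 1).toNNReal P := by
  refine ⟨integrable_exp_mul_of_abs_le hX hB, fun t => ?_⟩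
  rw [Real.coe_toNNReal _ (by positivity)]
  have he : 0 < Real.exp 1 := Real.exp_pos 1
  have hXint : Integrable X P := integrable_of_abs_le hX B hB
  set E := K * Real.exp 1 with hE
  have hE0 : 0 < E := by positivity
  unfold mgf
  -- For small t the zero mean removes the linear term. For large t, tx ≤ t²E/2 + x²/(2E), and the
  -- leftover factor 2 is at most exp(2t²E) because 2t²E ≥ 1. The exponents add up to (5/2)t²E,
  -- whence the constant 5.
  rcases le_total (t ^ 2 * E) (1 / 2) with ht | ht
  · calc ∫ ω, Real.exp (t * X ω) ∂P
        ≤ ∫ ω, (t * X ω + Real.exp (t ^ 2 * X ω ^ 2)) ∂P := by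
          refine integral_mono (integrable_exp_mul_of_abs_le hX hB t)
            ((hXint.const_mul t).add (integrable_exp_mul_sq hX hB _)) fun ω => ?_
          have := exp_le_add_exp_sq (t * X ω)
          rwa [mul_pow] at this
      _ = ∫ ω, Real.exp (t ^ 2 * X ω ^ 2) ∂P := by
          rw [integral_add (hXint.const_mul t) (integrable_exp_mul_sq hX hB _),
            integral_const_mul, hmean]; simp
      _ ≤ 1 + 2 * (t ^ 2 * K * Real.exp 1) :=
          integral_exp_mul_sq_le hX hB hK.le hmom (sq_nonneg t) (by rw [mul_assoc]; exact ht)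
      _ ≤ Real.exp (2 * (t ^ 2 * K * Real.exp 1)) := by
          rw [add_comm]; exact Real.add_one_le_exp _
      _ ≤ Real.exp (5 * K * Real.exp 1 * t ^ 2 / 2) := by
          rw [Real.exp_le_exp]; nlinarith [mul_nonneg (sq_nonneg t) hE0.le]
  · have hs : (1 / (2 * E)) * K * Real.exp 1 = 1 / 2 := by rw [hE]; field_simp
    have h2 := integral_exp_mul_sq_le hX hB hK.le hmom (s := 1 / (2 * E)) (by positivity) hs.le
    rw [hs] at h2
    calc ∫ ω, Real.exp (t * X ω) ∂P
        ≤ ∫ ω, Real.exp (t ^ 2 * E / 2) * Real.exp (1 / (2 * E) * X ω ^ 2) ∂P := by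
          refine integral_mono (integrable_exp_mul_of_abs_le hX hB t)
            ((integrable_exp_mul_sq hX hB _).const_mul _) fun ω => ?_
          dsimp only
          rw [← Real.exp_add, Real.exp_le_exp]
          have : t ^ 2 * E / 2 + 1 / (2 * E) * X ω ^ 2 - t * X ω
              = (t * E - X ω) ^ 2 / (2 * E) := by field_simp; ring
          have : 0 ≤ (t * E - X ω) ^ 2 / (2 * E) := by positivity
          linarith
      _ = Real.exp (t ^ 2 * E / 2) * ∫ ω, Real.exp (1 / (2 * E) * X ω ^ 2) ∂P :=
          integral_const_mul _ _
      _ ≤ Real.exp (t ^ 2 * E / 2) * Real.exp (2 * (t ^ 2 * E)) := by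
          gcongr
          have := Real.add_one_le_exp (2 * (t ^ 2 * E))
          linarith
      _ = Real.exp (5 * K * Real.exp 1 * t ^ 2 / 2) := by
          rw [← Real.exp_add, hE]; congr 1; ring

/-- Even moments of a sub-Gaussian variable. -/
lemma integral_even_pow_le_of_hasSubgaussianMGF {c : ℝ≥0} (hc : 0 < c)
    (hX : HasSubgaussianMGF X c P) (m : ℕ) :
    ∫ ω, X ω ^ (2 * m) ∂P ≤ (4 * Real.exp 1 * c * m) ^ m := by
  rcases Nat.eq_zero_or_pos m with rfl | hm
  · simp
  have hm' : (0 : ℝ) < m := by exact_mod_cast hm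
  have hc' : (0 : ℝ) < c := by exact_mod_cast hc
  -- The minimiser of t^{-2m} exp(ct²/2).
  set t : ℝ := Real.sqrt (2 * m / c) with ht
  have ht2 : t ^ 2 = 2 * m / c := Real.sq_sqrt (by positivity)
  have htpow : t ^ (2 * m) = (2 * m / c) ^ m := by rw [pow_mul, ht2]
  have hpos : 0 < t ^ (2 * m) := by rw [htpow]; positivity
  have hfac : ((2 * m).factorial : ℝ) ≤ (2 * m : ℝ) ^ (2 * m) := by
    exact_mod_cast Nat.factorial_le_pow (2 * m)
  have hexp : ∀ u : ℝ, u ^ 2 = t ^ 2 → ∫ ω, Real.exp (u * X ω) ∂P ≤ Real.exp 1 ^ m := by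
    intro u hu
    have := hX.mgf_le u
    rw [hu, ht2] at this
    refine this.trans (le_of_eq ?_)
    rw [Real.exp_one_pow]; congr 1; field_simp
  have hpt : ∀ ω, X ω ^ (2 * m) ≤
      (2 * m).factorial / t ^ (2 * m) * (Real.exp (t * X ω) + Real.exp ((-t) * X ω)) := by
    intro ω
    have h1 := Real.pow_div_factorial_le_exp |t * X ω| (abs_nonneg _) (2 * m)
    have h2 := h1.trans (Real.exp_abs_le (t * X ω))
    rw [Even.pow_abs (even_two_mul m), mul_pow, div_le_iff₀ (by positivity)] at h2
    rw [div_mul_eq_mul_div, le_div_iff₀ hpos, neg_mul]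
    linarith
  have hInt : Integrable (fun ω => (2 * m).factorial / t ^ (2 * m) *
      (Real.exp (t * X ω) + Real.exp ((-t) * X ω))) P :=
    ((hX.integrable_exp_mul t).add (hX.integrable_exp_mul (-t))).const_mul _
  calc ∫ ω, X ω ^ (2 * m) ∂P
      ≤ ∫ ω, (2 * m).factorial / t ^ (2 * m) *
          (Real.exp (t * X ω) + Real.exp ((-t) * X ω)) ∂P :=
        integral_mono_of_nonneg (Filter.Eventually.of_forall fun ω =>
          (even_two_mul m).pow_nonneg _) hInt (Filter.Eventually.of_forall hpt)
    _ = (2 * m).factorial / t ^ (2 * m) *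
          (∫ ω, Real.exp (t * X ω) ∂P + ∫ ω, Real.exp ((-t) * X ω) ∂P) := by
        rw [integral_const_mul, integral_add (hX.integrable_exp_mul t)
          (hX.integrable_exp_mul (-t))]
    _ ≤ (2 * m : ℝ) ^ (2 * m) / t ^ (2 * m) * (Real.exp 1 ^ m + Real.exp 1 ^ m) := by
        gcongr
        · exact hexp t rfl
        · exact hexp (-t) (by ring)
    _ = 2 * (2 * Real.exp 1 * c * m) ^ m := by
        rw [htpow, pow_mul, ← div_pow]
        have : (2 * (m : ℝ)) ^ 2 / (2 * m / c) = 2 * c * m := by field_simp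
        rw [this, ← two_mul, mul_left_comm, ← mul_pow]
        congr 2; ring
    _ ≤ 2 ^ m * (2 * Real.exp 1 * c * m) ^ m := by
        gcongr
        exact le_self_pow₀ (by norm_num) hm.ne'
    _ = (4 * Real.exp 1 * c * m) ^ m := by rw [← mul_pow]; congr 1; ring

end Moments

/-- A sum of squares whose exponential moments are at most `2` obeys an exponential tail bound. -/
lemma measureReal_sum_sq_gt_le {Ω ι : Type*} [MeasurableSpace Ω] {P : Measure Ω}
    [IsProbabilityMeasure P] (A : Finset ι) (X : ι → Ω → ℝ) {s δ : ℝ} (hs : 0 < s) (hδ : 0 < δ)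
    (hInt : ∀ a ∈ A, Integrable (fun ω => Real.exp (s * X a ω ^ 2)) P)
    (hexp : ∀ a ∈ A, ∫ ω, Real.exp (s * X a ω ^ 2) ∂P ≤ 2) :
    P.real {ω | (A.card : ℝ) * (Real.log (2 / δ) / s) < ∑ a ∈ A, X a ω ^ 2} ≤ δ := by
  rcases A.eq_empty_or_nonempty with rfl | hA
  · simpa using hδ.le
  have hN : (0 : ℝ) < A.card := by exact_mod_cast hA.card_pos
  -- Averaging the exponentials and using convexity of exp replaces independence: F has mean at most
  -- 2 whatever the joint law, and Markov is applied at level 2/δ.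
  set F : Ω → ℝ := fun ω => ∑ a ∈ A, (A.card : ℝ)⁻¹ * Real.exp (s * X a ω ^ 2) with hF
  have hFint : Integrable F P := integrable_finsetSum _ fun a ha => (hInt a ha).const_mul _
  have hF2 : ∫ ω, F ω ∂P ≤ 2 := by
    rw [hF, integral_finsetSum _ fun a ha => (hInt a ha).const_mul _]
    calc ∑ a ∈ A, ∫ ω, (A.card : ℝ)⁻¹ * Real.exp (s * X a ω ^ 2) ∂P
        ≤ ∑ a ∈ A, (A.card : ℝ)⁻¹ * 2 := Finset.sum_le_sum fun a ha => by
          rw [integral_const_mul]; gcongr; exact hexp a ha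
      _ = 2 := by rw [Finset.sum_const, nsmul_eq_mul]; field_simp
  have hsub : {ω | (A.card : ℝ) * (Real.log (2 / δ) / s) < ∑ a ∈ A, X a ω ^ 2} ⊆
      {ω | 2 / δ ≤ F ω} := by
    intro ω hω
    have hω' : (A.card : ℝ) * (Real.log (2 / δ) / s) < ∑ a ∈ A, X a ω ^ 2 := hω
    have hconv := convexOn_exp.map_sum_le (t := A) (w := fun _ => (A.card : ℝ)⁻¹)
      (p := fun a => s * X a ω ^ 2) (fun _ _ => by positivity)
      (by rw [Finset.sum_const, nsmul_eq_mul]; field_simp) (fun _ _ => Set.mem_univ _)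
    simp only [smul_eq_mul] at hconv
    refine le_trans ?_ hconv
    rw [← Real.log_le_iff_le_exp (by positivity), ← Finset.mul_sum, ← Finset.mul_sum]
    rw [mul_div_assoc', div_lt_iff₀ hs] at hω'
    rw [inv_mul_eq_div, le_div_iff₀ hN]
    linarith
  have hmarkov := mul_meas_ge_le_integral_of_nonneg (μ := P) (f := F)
    (Filter.Eventually.of_forall fun ω => Finset.sum_nonneg fun a _ => by positivity) hFint (2 / δ)
  have h3 := measureReal_mono hsub (μ := P)
  have : 2 / δ * P.real {ω | 2 / δ ≤ F ω} ≤ 2 := hmarkov.trans hF2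
  rw [div_mul_eq_mul_div, div_le_iff₀ hδ] at this
  linarith

/-! ### The spectrum of the path Laplacian -/

lemma card_filter_div_eq_le {L : ℕ} (hL : 0 < L) (N b : ℕ) :
    ((Finset.range N).filter fun i => i / L = b).card ≤ L := by
  calc _ ≤ (Finset.Ico (b * L) (b * L + L)).card := by
        refine Finset.card_le_card fun i hi => ?_
        obtain ⟨-, rfl⟩ := Finset.mem_filter.1 hi
        rw [Finset.mem_Ico]
        exact ⟨Nat.div_mul_le_self i L, by
          have := Nat.lt_mul_div_succ i hL
          rw [Nat.mul_succ, Nat.mul_comm] at this; exact this⟩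
    _ = L := by simp

/-- Cauchy–Schwarz on the telescoping sum; every edge between i and j stays inside their common
block, which has at most L elements. -/
lemma sq_sub_le_of_div_eq {L N i j : ℕ} (hL : 0 < L) (y : ℕ → ℝ) (hij : i ≤ j) (hj : j < N)
    (h : i / L = j / L) :
    (y i - y j) ^ 2 ≤
      L * ∑ k ∈ (Finset.range (N - 1)).filter (fun k => k / L = i / L), (y k - y (k + 1)) ^ 2 := by
  have htel : y i - y j = ∑ k ∈ Finset.Ico i j, (y k - y (k + 1)) := by
    rw [← neg_inj, ← Finset.sum_neg_distrib, neg_sub, ← Finset.sum_Ico_sub y hij]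
    exact Finset.sum_congr rfl fun k _ => by ring
  have hsub : Finset.Ico i j ⊆ (Finset.range (N - 1)).filter (fun k => k / L = i / L) := by
    intro k hk
    rw [Finset.mem_Ico] at hk
    rw [Finset.mem_filter, Finset.mem_range]
    refine ⟨by omega, le_antisymm ?_ (Nat.div_le_div_right hk.1)⟩
    rw [h]; exact Nat.div_le_div_right hk.2.le
  have hcard : (Finset.Ico i j).card ≤ L :=
    (Finset.card_le_card hsub).trans (card_filter_div_eq_le hL _ _)
  rw [htel]
  calc _ ≤ ((Finset.Ico i j).card : ℝ) * ∑ k ∈ Finset.Ico i j, (y k - y (k + 1)) ^ 2 :=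
        sq_sum_le_card_mul_sum_sq
    _ ≤ _ := by
        gcongr

/-- Discrete Poincaré inequality for a sequence with zero mean on blocks of length `L`. -/
lemma sum_sq_le_of_block_sum_eq_zero {L N : ℕ} (hL : 0 < L) (y : ℕ → ℝ)
    (hy : ∀ b, ∑ i ∈ (Finset.range N).filter (fun i => i / L = b), y i = 0) :
    ∑ i ∈ Finset.range N, y i ^ 2 ≤
      (L : ℝ) ^ 2 * ∑ k ∈ Finset.range (N - 1), (y k - y (k + 1)) ^ 2 := by
  have hpt : ∀ i ∈ Finset.range N, y i ^ 2 ≤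
      L * ∑ k ∈ (Finset.range (N - 1)).filter (fun k => k / L = i / L),
        (y k - y (k + 1)) ^ 2 := by
    intro i hi
    have hi' : i ∈ (Finset.range N).filter (fun j => j / L = i / L) :=
      Finset.mem_filter.2 ⟨hi, rfl⟩
    -- Zero block sum forces some entry of the block to have sign opposite to y i (or one of the two
    -- to vanish), so y i is dominated by a difference.
    obtain ⟨j, hj, hji⟩ : ∃ j ∈ (Finset.range N).filter (fun j => j / L = i / L),
        y i * y j ≤ 0 := by
      refine Finset.exists_le_of_sum_le ⟨i, hi'⟩ ?_
      rw [← Finset.mul_sum, hy]; simp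
    obtain ⟨hjN, hjL⟩ := Finset.mem_filter.1 hj
    rw [Finset.mem_range] at hi hjN
    have h1 : y i ^ 2 ≤ (y i - y j) ^ 2 := by nlinarith [sq_nonneg (y j)]
    refine h1.trans ?_
    rcases le_total i j with hle | hle
    · exact sq_sub_le_of_div_eq hL y hle hjN hjL.symm
    · have := sq_sub_le_of_div_eq hL y hle hi hjL
      rw [hjL] at this
      calc (y i - y j) ^ 2 = (y j - y i) ^ 2 := by ring
        _ ≤ _ := this
  calc ∑ i ∈ Finset.range N, y i ^ 2
      ≤ ∑ i ∈ Finset.range N, (L : ℝ) *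
          ∑ k ∈ (Finset.range (N - 1)).filter (fun k => k / L = i / L),
            (y k - y (k + 1)) ^ 2 := Finset.sum_le_sum hpt
    -- After exchanging the sums, each edge is counted once for every vertex of its block.
    _ = L * ∑ k ∈ Finset.range (N - 1),
          (((Finset.range N).filter fun i => i / L = k / L).card : ℝ) * (y k - y (k + 1)) ^ 2 := by
        rw [← Finset.mul_sum]
        congr 1
        simp_rw [Finset.sum_filter]
        rw [Finset.sum_comm]
        refine Finset.sum_congr rfl fun k _ => ?_
        rw [← Finset.sum_filter, Finset.sum_const, nsmul_eq_mul]
        simp only [eq_comm]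
    _ ≤ L * ∑ k ∈ Finset.range (N - 1), (L : ℝ) * (y k - y (k + 1)) ^ 2 := by
        gcongr with k _
        exact card_filter_div_eq_le hL _ _
    _ = _ := by rw [← Finset.mul_sum]; ring

/-- The Dirichlet energy of a function on the path. -/
noncomputable def pathEnergy {T : ℕ} (x : Fin T → ℝ) : ℝ :=
  ∑ k : Fin (T - 1), (x ⟨k, by omega⟩ - x ⟨k + 1, by omega⟩) ^ 2

/-- The Laplacian form is half a sum over ordered adjacent pairs; each edge of the path occurs there
once in each direction. -/
lemma dotProduct_pathLaplacian_mulVec {T : ℕ} (x : Fin T → ℝ) :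
    x ⬝ᵥ (pathLaplacian T).mulVec x = pathEnergy x := by
  classical
  unfold pathLaplacian
  let := Classical.decRel (SimpleGraph.pathGraph T).Adj
  have h := (SimpleGraph.pathGraph T).lapMatrix_toLinearMap₂' ℝ x
  rw [Matrix.toLinearMap₂'_apply'] at h
  refine h.trans ?_
  cases T with
  | zero => simp [pathEnergy]
  | succ N =>
    have hone : ∑ i : Fin (N + 1), ∑ j : Fin (N + 1),
        (if (i : ℕ) + 1 = j then (x i - x j) ^ 2 else 0) = pathEnergy x := by
      rw [Fin.sum_univ_castSucc]
      have hlast : ∑ j : Fin (N + 1),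
          (if ((Fin.last N : Fin (N + 1)) : ℕ) + 1 = j then (x (Fin.last N) - x j) ^ 2 else 0)
            = 0 := Finset.sum_eq_zero fun j _ => if_neg (by simp; omega)
      rw [hlast, add_zero]
      refine Finset.sum_congr rfl fun i _ => ?_
      rw [Finset.sum_eq_single i.succ]
      · rw [if_pos (by simp)]; rfl
      · intro j _ hj
        refine if_neg fun hij => hj ?_
        ext; simpa using hij.symm
      · simp
    have htwo : ∑ i : Fin (N + 1), ∑ j : Fin (N + 1),
        (if (j : ℕ) + 1 = i then (x i - x j) ^ 2 else 0) = pathEnergy x := by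
      rw [Finset.sum_comm, ← hone]
      refine Finset.sum_congr rfl fun i _ => Finset.sum_congr rfl fun j _ => ?_
      split_ifs <;> ring
    have hsplit : ∀ i j : Fin (N + 1),
        (if (SimpleGraph.pathGraph (N + 1)).Adj i j then (x i - x j) ^ 2 else 0) =
          (if (i : ℕ) + 1 = j then (x i - x j) ^ 2 else 0) +
          (if (j : ℕ) + 1 = i then (x i - x j) ^ 2 else 0) := by
      intro i j
      simp only [SimpleGraph.pathGraph_adj]
      by_cases h1 : (i : ℕ) + 1 = j
      · have h2 : ¬ (j : ℕ) + 1 = i := by omega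
        simp [h1, h2]
      · simp [h1]
    simp_rw [hsplit, Finset.sum_add_distrib]
    rw [hone, htwo]; ring

section Eigenbasis

variable {T : ℕ} {lam : Fin T → ℝ} {v : OrthonormalBasis (Fin T) ℝ (EuclideanSpace ℝ (Fin T))}

lemma sum_sq_eq_sum_inner_sq (v : OrthonormalBasis (Fin T) ℝ (EuclideanSpace ℝ (Fin T)))
    (x : Fin T → ℝ) : ∑ k, x k ^ 2 = ∑ l, (∑ k, v l k * x k) ^ 2 := by
  have h := v.sum_sq_norm_inner_right (WithLp.toLp 2 x)
  rw [EuclideanSpace.norm_sq_eq] at h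
  simp only [Real.norm_eq_abs, sq_abs, PiLp.inner_apply] at h
  rw [← h]
  refine Finset.sum_congr rfl fun l _ => ?_
  congr 1
  exact Finset.sum_congr rfl fun k _ => by simp [mul_comm]

lemma sum_mul_eq_ite (v : OrthonormalBasis (Fin T) ℝ (EuclideanSpace ℝ (Fin T))) (l m : Fin T) :
    ∑ k, v l k * v m k = if l = m then 1 else 0 := by
  have h := orthonormal_iff_ite.1 v.orthonormal l m
  rw [PiLp.inner_apply] at h
  rw [← h]
  exact Finset.sum_congr rfl fun k _ => by simp [mul_comm]

lemma eq_sum_inner_mul (v : OrthonormalBasis (Fin T) ℝ (EuclideanSpace ℝ (Fin T)))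
    (x : Fin T → ℝ) (i : Fin T) : x i = ∑ l, (∑ k, v l k * x k) * v l i := by
  have h := congrArg (fun z : EuclideanSpace ℝ (Fin T) => z i) (v.sum_repr' (WithLp.toLp 2 x))
  simp only [PiLp.inner_apply, WithLp.ofLp_sum, Finset.sum_apply, WithLp.ofLp_smul,
    Pi.smul_apply, smul_eq_mul] at h
  rw [← h]
  refine Finset.sum_congr rfl fun l _ => ?_
  congr 1
  exact Finset.sum_congr rfl fun k _ => by simp [mul_comm]

lemma pathEnergy_eq_sum_eigen (hv : IsSortedEigenbasis lam v) (x : Fin T → ℝ) :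
    pathEnergy x = ∑ l, lam l * (∑ k, v l k * x k) ^ 2 := by
  have hx : x = ∑ l, (∑ k, v l k * x k) • (v l).ofLp := by
    ext i; rw [Finset.sum_apply]; exact eq_sum_inner_mul v x i
  have hLx : (pathLaplacian T).mulVec x =
      ∑ l, (∑ k, v l k * x k) • (pathLaplacian T).mulVec (v l).ofLp := by
    conv_lhs => rw [hx]
    rw [Matrix.mulVec_sum]
    exact Finset.sum_congr rfl fun l _ => Matrix.mulVec_smul _ _ _
  rw [← dotProduct_pathLaplacian_mulVec, hLx, dotProduct_sum]
  refine Finset.sum_congr rfl fun l _ => ?_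
  rw [hv.eigen, dotProduct_smul, dotProduct_smul]
  have : x ⬝ᵥ (v l).ofLp = ∑ k, v l k * x k :=
    Finset.sum_congr rfl fun k _ => mul_comm _ _
  rw [this]; simp only [smul_eq_mul]; ring

/-- Beyond the `τ` smallest eigenvalues, the path Laplacian is at least `τ² / (4 T²)`. -/
lemma eigenvalue_ge (hv : IsSortedEigenbasis lam v) {τ : ℕ} (hτ : 1 ≤ τ) {l : Fin T}
    (hl : (l : ℕ) + τ < T) : (τ : ℝ) ^ 2 / (4 * (T : ℝ) ^ 2) ≤ lam l := by
  classical
  -- L = ⌈T/τ⌉, so τ blocks of length L cover the path, while τ ≤ T gives τL ≤ 2T.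
  set L : ℕ := (T + τ - 1) / τ with hLdef
  have hTL : T ≤ τ * L := by
    have := Nat.lt_mul_div_succ (T + τ - 1) (show 0 < τ by omega)
    rw [Nat.mul_succ, ← hLdef] at this
    omega
  have hLT : τ * L ≤ 2 * T := by
    have := Nat.mul_div_le (T + τ - 1) τ
    rw [← hLdef] at this
    omega
  have hL : 0 < L := by
    rcases Nat.eq_zero_or_pos L with h | h
    · rw [h] at hTL; omega
    · exact h
  -- Since l + τ < T, some nonzero x is orthogonal to the l eigenvectors before `v l` and has zero
  -- sum on each of the τ blocks. Sorting then gives energy ≤ λ_l ‖x‖², and Poincaré gives ‖x‖² ≤ L²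
  -- · energy.
  let Φ : (Fin T → ℝ) →ₗ[ℝ] ((Fin l → ℝ) × (Fin τ → ℝ)) :=
    { toFun := fun x => (fun m => ∑ k, v ⟨m, by omega⟩ k * x k,
        fun b => ∑ i : Fin T, if (i : ℕ) / L = b then x i else 0)
      map_add' := by
        intro x y
        ext a
        · simp [mul_add, Finset.sum_add_distrib]
        · simp only [Pi.add_apply, Prod.snd_add, ← Finset.sum_add_distrib]
          exact Finset.sum_congr rfl fun i _ => by split_ifs <;> simp
      map_smul' := by
        intro c x
        ext a
        · simp [Finset.mul_sum, mul_left_comm]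
        · simp [Finset.mul_sum] }
  have hker : LinearMap.ker Φ ≠ ⊥ := LinearMap.ker_ne_bot_of_finrank_lt (by
    rw [Module.finrank_prod, Module.finrank_fin_fun, Module.finrank_fin_fun,
      Module.finrank_fin_fun]; exact hl)
  obtain ⟨x, hxk, hx0⟩ := (Submodule.ne_bot_iff _).1 hker
  rw [LinearMap.mem_ker] at hxk
  have hlow : ∀ m : Fin T, m < l → ∑ k, v m k * x k = 0 := fun m hm =>
    congrFun (congrArg Prod.fst hxk) ⟨m, hm⟩
  have hblock : ∀ b : Fin τ, (∑ i : Fin T, if (i : ℕ) / L = b then x i else 0) = 0 := fun b =>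
    congrFun (congrArg Prod.snd hxk) b
  -- The default value 0 never enters: the sums below only meet indices less than T.
  let y : ℕ → ℝ := fun i => if h : i < T then x ⟨i, h⟩ else 0
  have hyx : ∀ i : Fin T, y i = x i := fun i => by simp [y]
  have hy : ∀ b, ∑ i ∈ (Finset.range T).filter (fun i => i / L = b), y i = 0 := by
    intro b
    rw [Finset.sum_filter, Finset.sum_range]
    simp_rw [hyx]
    by_cases hb : b < τ
    · exact hblock ⟨b, hb⟩
    · refine Finset.sum_eq_zero fun i _ => if_neg fun h => hb ?_
      rw [← h]
      exact (Nat.div_lt_iff_lt_mul hL).2 (lt_of_lt_of_le i.2 hTL)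
  have hpo := sum_sq_le_of_block_sum_eq_zero hL y hy
  have hE : ∑ k ∈ Finset.range (T - 1), (y k - y (k + 1)) ^ 2 = pathEnergy x := by
    rw [Finset.sum_range]
    refine Finset.sum_congr rfl fun k _ => ?_
    have h1 : (k : ℕ) < T := by omega
    have h2 : (k : ℕ) + 1 < T := by omega
    simp [y, h1, h2]
  rw [hE, Finset.sum_range] at hpo
  simp_rw [hyx] at hpo
  set s := ∑ k, x k ^ 2 with hs
  have hspos : 0 < s := by
    obtain ⟨i, hi⟩ := Function.ne_iff.1 hx0
    exact Finset.sum_pos' (fun _ _ => sq_nonneg _) ⟨i, Finset.mem_univ _, by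
      have : x i ≠ 0 := hi
      positivity⟩
  have hupper : pathEnergy x ≤ lam l * s := by
    rw [pathEnergy_eq_sum_eigen hv, hs, sum_sq_eq_sum_inner_sq v, Finset.mul_sum]
    refine Finset.sum_le_sum fun m _ => ?_
    rcases lt_or_ge m l with hm | hm
    · rw [hlow m hm]; simp
    · exact mul_le_mul_of_nonneg_right (hv.antitone hm) (sq_nonneg _)
  have hL' : (0 : ℝ) < L := by exact_mod_cast hL
  have h1 : 1 ≤ (L : ℝ) ^ 2 * lam l := by
    have : s ≤ (L : ℝ) ^ 2 * (lam l * s) := hpo.trans (by gcongr)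
    by_contra hcon
    push Not at hcon
    nlinarith
  have hT0 : 0 < T := by omega
  have hT' : (0 : ℝ) < T := by exact_mod_cast hT0
  have hLT' : (τ : ℝ) * L ≤ 2 * T := by exact_mod_cast hLT
  rw [div_le_iff₀ (by positivity)]
  have hlam : 0 < lam l := by
    by_contra hcon
    push Not at hcon
    nlinarith [sq_nonneg (L : ℝ)]
  calc (τ : ℝ) ^ 2 = (τ : ℝ) ^ 2 * 1 := (mul_one _).symm
    _ ≤ (τ : ℝ) ^ 2 * ((L : ℝ) ^ 2 * lam l) := by gcongr
    _ = lam l * (τ * L) ^ 2 := by ring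
    _ ≤ lam l * (2 * T) ^ 2 := by gcongr
    _ = _ := by ring

end Eigenbasis

/-! ### Spectral decomposition of the error -/

section Spectral

variable {n T : ℕ} (v : OrthonormalBasis (Fin T) ℝ (EuclideanSpace ℝ (Fin T)))

/-- The coefficients of a complex sequence in the basis `v`. -/
noncomputable def coef (z : Fin T → ℂ) (l : Fin T) : ℂ := ∑ k, (v l k : ℂ) * z k

lemma coef_sub (z w : Fin T → ℂ) (l : Fin T) :
    coef v (fun k => z k - w k) l = coef v z l - coef v w l := by
  simp [coef, mul_sub, Finset.sum_sub_distrib]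

lemma coef_re (z : Fin T → ℂ) (l : Fin T) : (coef v z l).re = ∑ k, v l k * (z k).re := by
  simp [coef]

lemma coef_im (z : Fin T → ℂ) (l : Fin T) : (coef v z l).im = ∑ k, v l k * (z k).im := by
  simp [coef]

lemma norm_sq_eq_re_add_im (z : ℂ) : ‖z‖ ^ 2 = z.re ^ 2 + z.im ^ 2 := by
  rw [Complex.sq_norm, Complex.normSq_apply]; ring

/-- The basis is real, so Parseval applies to real and imaginary parts separately. -/
lemma sum_norm_sq_eq_sum_coef (z : Fin T → ℂ) :
    ∑ k, ‖z k‖ ^ 2 = ∑ l, ‖coef v z l‖ ^ 2 := by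
  simp_rw [norm_sq_eq_re_add_im, coef_re, coef_im, Finset.sum_add_distrib]
  rw [sum_sq_eq_sum_inner_sq v, sum_sq_eq_sum_inner_sq v fun k => (z k).im]

lemma frobSq_eq_sum_coef (X : Matrix (Fin T × Fin n) (Fin n) ℂ) :
    frobSq X = ∑ i, ∑ j, ∑ l, ‖coef v (fun k => X (k, i) j) l‖ ^ 2 := by
  simp_rw [← sum_norm_sq_eq_sum_coef, frobSq, Fintype.sum_prod_type]
  rw [Finset.sum_comm]
  exact Finset.sum_congr rfl fun i _ => Finset.sum_comm

/-- The indices of the `τ` smallest eigenvalues. -/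
def lowIdx (T τ : ℕ) : Finset (Fin T) := Finset.univ.filter fun k : Fin T => T ≤ (k : ℕ) + τ

lemma mem_lowIdx {τ : ℕ} {k : Fin T} : k ∈ lowIdx T τ ↔ T ≤ (k : ℕ) + τ := by simp [lowIdx]

lemma card_lowIdx_le (T τ : ℕ) : (lowIdx T τ).card ≤ τ := by
  calc (lowIdx T τ).card = ((lowIdx T τ).map Fin.valEmbedding).card := (Finset.card_map _).symm
    _ ≤ (Finset.Ico (T - τ) T).card := Finset.card_le_card fun i hi => by
        obtain ⟨k, hk, rfl⟩ := Finset.mem_map.1 hi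
        rw [mem_lowIdx] at hk
        have := k.2
        simp only [Fin.valEmbedding_apply, Finset.mem_Ico]
        omega
    _ ≤ τ := by simp; omega

lemma proj_mul_apply (τ : ℕ) (X : Matrix (Fin T × Fin n) (Fin n) ℂ) (k : Fin T) (i j : Fin n) :
    (proj v τ n * X) (k, i) j = ∑ l ∈ lowIdx T τ, (v l k : ℂ) * coef v (fun k => X (k, i) j) l := by
  rw [Matrix.mul_apply, Fintype.sum_prod_type]
  have h : ∀ k', ∑ i', proj v τ n (k, i) (k', i') * X (k', i') j =
      ∑ l ∈ lowIdx T τ, (v l k : ℂ) * ((v l k' : ℂ) * X (k', i) j) := by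
    intro k'
    rw [Finset.sum_eq_single i]
    · simp [proj, lowFreq, Matrix.sum_apply, Matrix.vecMulVec_apply, lowIdx, Finset.sum_mul,
        mul_assoc]
    · intro i' _ hi'
      simp [proj, Matrix.one_apply_ne' hi']
    · simp
  simp_rw [h]
  rw [Finset.sum_comm]
  simp_rw [coef, Finset.mul_sum]

/-- In spectral coordinates the projection is truncation to the low indices, by orthonormality. -/
lemma coef_proj_mul (τ : ℕ) (X : Matrix (Fin T × Fin n) (Fin n) ℂ) (i j : Fin n) (m : Fin T) :
    coef v (fun k => (proj v τ n * X) (k, i) j) m =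
      if m ∈ lowIdx T τ then coef v (fun k => X (k, i) j) m else 0 := by
  simp_rw [coef.eq_def v (fun k => (proj v τ n * X) (k, i) j), proj_mul_apply, Finset.mul_sum]
  rw [Finset.sum_comm]
  have h : ∀ l, ∑ k, (v m k : ℂ) * ((v l k : ℂ) * coef v (fun k => X (k, i) j) l) =
      if m = l then coef v (fun k => X (k, i) j) l else 0 := by
    intro l
    simp_rw [← mul_assoc]
    rw [← Finset.sum_mul]
    have := sum_mul_eq_ite v m l
    have h2 : ∑ k, (v m k : ℂ) * (v l k : ℂ) = ((∑ k, v m k * v l k : ℝ) : ℂ) := by push_cast; rfl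
    rw [h2, this]
    split_ifs <;> simp
  simp_rw [h]
  simp

lemma frobSq_one_sub_proj_mul (τ : ℕ) (Y : Matrix (Fin T × Fin n) (Fin n) ℂ) :
    frobSq ((1 - proj v τ n) * Y) =
      ∑ i, ∑ j, ∑ l, if l ∈ lowIdx T τ then 0 else ‖coef v (fun k => Y (k, i) j) l‖ ^ 2 := by
  rw [frobSq_eq_sum_coef v, Matrix.sub_mul, Matrix.one_mul]
  simp_rw [Matrix.sub_apply, coef_sub, coef_proj_mul]
  refine Finset.sum_congr rfl fun i _ => Finset.sum_congr rfl fun j _ =>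
    Finset.sum_congr rfl fun l _ => ?_
  split_ifs <;> simp

/-- Bias-variance decomposition. -/
lemma frobSq_proj_mul_sub (τ : ℕ) (X Y : Matrix (Fin T × Fin n) (Fin n) ℂ) :
    frobSq (proj v τ n * X - Y) =
      (∑ i, ∑ j, ∑ l ∈ lowIdx T τ, ‖coef v (fun k => (X - Y) (k, i) j) l‖ ^ 2) +
        frobSq ((1 - proj v τ n) * Y) := by
  rw [frobSq_one_sub_proj_mul, frobSq_eq_sum_coef v]
  simp_rw [← Finset.sum_add_distrib, Matrix.sub_apply, coef_sub, coef_proj_mul]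
  refine Finset.sum_congr rfl fun i _ => Finset.sum_congr rfl fun j _ => ?_
  -- Each index feeds only one summand: low ones the coefficient of X - Y, high ones that of Y.
  rw [← Finset.sum_ite_mem_eq (lowIdx T τ), ← Finset.sum_add_distrib]
  refine Finset.sum_congr rfl fun l _ => ?_
  split_ifs <;> simp

end Spectral

/-! ### The bias -/

section Bias

variable {n T : ℕ} {lam : Fin T → ℝ}
  {v : OrthonormalBasis (Fin T) ℝ (EuclideanSpace ℝ (Fin T))} {g : Fin T → Fin n → ℂ} {S : ℝ}

lemma norm_sq_mul_star_sub_le {a b a' b' : ℂ} (hb : ‖b‖ = 1) (ha' : ‖a'‖ = 1) :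
    ‖a * star b - a' * star b'‖ ^ 2 ≤ 2 * ‖a - a'‖ ^ 2 + 2 * ‖b - b'‖ ^ 2 := by
  have h : a * star b - a' * star b' = (a - a') * star b + a' * star (b - b') := by
    rw [star_sub]; ring
  have h1 : ‖a * star b - a' * star b'‖ ≤ ‖a - a'‖ + ‖b - b'‖ := by
    rw [h]
    refine (norm_add_le _ _).trans ?_
    rw [norm_mul, norm_mul, norm_star, norm_star, hb, ha', mul_one, one_mul]
  calc _ ≤ (‖a - a'‖ + ‖b - b'‖) ^ 2 := by gcongr
    _ ≤ _ := by nlinarith [sq_nonneg (‖a - a'‖ - ‖b - b'‖)]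

/-- The right-hand sum is ∑ λ_l |coef_l|². Low frequencies are dropped because λ_l ≥ 0, and high
ones use `eigenvalue_ge`. -/
lemma sum_coef_high_le (hv : IsSortedEigenbasis lam v) {τ : ℕ} (hτ : 1 ≤ τ) (hT : 0 < T)
    (z : Fin T → ℂ) :
    (∑ l, if l ∈ lowIdx T τ then 0 else ‖coef v z l‖ ^ 2) ≤
      4 * (T : ℝ) ^ 2 / (τ : ℝ) ^ 2 *
        ∑ k : Fin (T - 1), ‖z ⟨k, by omega⟩ - z ⟨k + 1, by omega⟩‖ ^ 2 := by
  have hτ' : (0 : ℝ) < τ := by exact_mod_cast hτ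
  have hT' : (0 : ℝ) < T := by exact_mod_cast hT
  have hlam0 : ∀ l, 0 ≤ lam l := by
    intro l
    have h := dotProduct_pathLaplacian_mulVec (v l).ofLp
    rw [hv.eigen, dotProduct_smul] at h
    have h1 : (v l).ofLp ⬝ᵥ (v l).ofLp = 1 := 
      (sum_mul_eq_ite v l l).trans (if_pos rfl)
    rw [h1, smul_eq_mul, mul_one] at h
    rw [h]
    exact Finset.sum_nonneg fun _ _ => sq_nonneg _
  have hen : ∑ k : Fin (T - 1), ‖z ⟨k, by omega⟩ - z ⟨k + 1, by omega⟩‖ ^ 2 =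
      ∑ l, lam l * ‖coef v z l‖ ^ 2 := by
    have h1 := pathEnergy_eq_sum_eigen hv fun k => (z k).re
    have h2 := pathEnergy_eq_sum_eigen hv fun k => (z k).im
    simp_rw [norm_sq_eq_re_add_im, coef_re, coef_im, mul_add, Finset.sum_add_distrib]
    rw [← h1, ← h2]
    rfl
  rw [hen, Finset.mul_sum]
  refine Finset.sum_le_sum fun l _ => ?_
  split_ifs with hl
  · have := hlam0 l
    positivity
  · rw [mem_lowIdx, not_le] at hl
    have h := eigenvalue_ge hv hτ hl
    rw [div_le_iff₀ (by positivity)] at h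
    rw [div_mul_eq_mul_div, le_div_iff₀ (by positivity)]
    nlinarith [sq_nonneg ‖coef v z l‖]

lemma frobSq_one_sub_proj_mul_Gbar_le (hg : ∀ k i, ‖g k i‖ = 1) (hS : SignalSmooth g S)
    (hv : IsSortedEigenbasis lam v) {τ : ℕ} (hτ : 1 ≤ τ) (hT : 0 < T) :
    frobSq ((1 - proj v τ n) * Gbar g) ≤ 16 * n * (T : ℝ) ^ 2 * S / (τ : ℝ) ^ 2 := by
  have hτ' : (0 : ℝ) < τ := by exact_mod_cast hτ
  rw [frobSq_one_sub_proj_mul]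
  let e : Fin n → Fin (T - 1) → ℝ :=
    fun i k => ‖g ⟨k, by omega⟩ i - g ⟨k + 1, by omega⟩ i‖ ^ 2
  have he : ∑ i, ∑ k, e i k ≤ S := by
    rw [Finset.sum_comm]; exact hS
  calc _ ≤ ∑ i : Fin n, ∑ j : Fin n, 4 * (T : ℝ) ^ 2 / (τ : ℝ) ^ 2 *
          ∑ k : Fin (T - 1), (2 * e i k + 2 * e j k) := by
        refine Finset.sum_le_sum fun i _ => Finset.sum_le_sum fun j _ => ?_
        refine (sum_coef_high_le hv hτ hT _).trans ?_
        gcongr with k _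
        have h : ∀ k : Fin T, Gbar g (k, i) j
            = g k i * star (g k j) - (1 : Matrix (Fin n) (Fin n) ℂ) i j := fun k => rfl
        -- The identity block is constant in time and cancels from the increments.
        rw [h, h, sub_sub_sub_cancel_right]
        exact norm_sq_mul_star_sub_le (hg _ _) (hg _ _)
    _ = 4 * (T : ℝ) ^ 2 / (τ : ℝ) ^ 2 * (4 * n * ∑ i, ∑ k, e i k) := by
        simp_rw [← Finset.mul_sum, Finset.sum_add_distrib, ← Finset.mul_sum, Finset.sum_const,
          nsmul_eq_mul, Finset.card_univ, Fintype.card_fin, ← Finset.mul_sum]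
        ring
    _ ≤ 4 * (T : ℝ) ^ 2 / (τ : ℝ) ^ 2 * (4 * n * S) := by gcongr
    _ = _ := by ring

end Bias

/-! ### Moments of the noise -/

lemma integral_rpow_abs_Qber_le_one (x : I) {q : ℝ} (hq : 0 ≤ q) :
    ∫ ω, |id ω| ^ q ∂(bernoulliMeasure (1 - (x : ℝ)) (-(x : ℝ)) x) ≤ 1 := by
  have hx0 := x.2.1
  have hx1 := x.2.2
  rw [integral_bernoulliMeasure]
  have h1 : |1 - (x : ℝ)| ^ q ≤ 1 :=
    Real.rpow_le_one (abs_nonneg _) (abs_le.2 ⟨by linarith, by linarith⟩) hq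
  have h2 : |-(x : ℝ)| ^ q ≤ 1 :=
    Real.rpow_le_one (abs_nonneg _) (abs_le.2 ⟨by linarith, by linarith⟩) hq
  simp only [id, smul_eq_mul]
  nlinarith

lemma Qber_nonneg (x : I) : 0 ≤ Qber x := by
  refine Real.iSup_nonneg fun q => ?_
  have hq : (0 : ℝ) ≤ q := zero_le_one.trans q.2
  exact mul_nonneg (Real.rpow_nonneg hq _) (Real.rpow_nonneg
    (integral_nonneg fun _ => Real.rpow_nonneg (abs_nonneg _) _) _)

/-- A real supremum dominates its terms only if the family is bounded; here 1 is a bound because |X|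
≤ 1. -/
lemma rpow_mul_le_Qber (x : I) {q : ℝ} (hq : 1 ≤ q) :
    q ^ (-(1 / 2) : ℝ) *
      (∫ ω, |id ω| ^ q ∂(bernoulliMeasure (1 - (x : ℝ)) (-(x : ℝ)) x)) ^ (1 / q) ≤ Qber x := by
  refine le_ciSup (f := fun q : Set.Ici (1 : ℝ) => (q : ℝ) ^ (-(1 / 2) : ℝ) *
    (∫ ω, |id ω| ^ (q : ℝ) ∂(bernoulliMeasure (1 - (x : ℝ)) (-(x : ℝ)) x)) ^ (1 / (q : ℝ)))
    ⟨1, ?_⟩ (⟨q, hq⟩ : Set.Ici (1 : ℝ))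
  rintro _ ⟨⟨r, hr⟩, rfl⟩
  have hr1 : (1 : ℝ) ≤ r := hr
  have hr0 : (0 : ℝ) ≤ r := zero_le_one.trans hr1
  refine mul_le_one₀ (Real.rpow_le_one_of_one_le_of_nonpos hr1 (by norm_num))
    (Real.rpow_nonneg (integral_nonneg fun _ => Real.rpow_nonneg (abs_nonneg _) _) _)
    (Real.rpow_le_one (integral_nonneg fun _ => Real.rpow_nonneg (abs_nonneg _) _)
      (integral_rpow_abs_Qber_le_one x hr0) (by positivity))

/-- Even moments of a centred Bernoulli variable. -/
lemma bernoulli_even_moment_le (x : I) {m : ℕ} (hm : 0 < m) {Q : ℝ} (hQ : Qber x ≤ Q) :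
    (x : ℝ) * (1 - (x : ℝ)) ^ (2 * m) + (1 - (x : ℝ)) * (x : ℝ) ^ (2 * m)
      ≤ (2 * Q ^ 2 * m) ^ m := by
  have hm' : (1 : ℝ) ≤ m := by exact_mod_cast hm
  -- The exponent q = 2m gives E X^{2m} ≤ Q^{2m} (2m)^m.
  have h := (rpow_mul_le_Qber x (q := (2 * m : ℕ)) (by push_cast; linarith)).trans hQ
  set M := ∫ ω, |id ω| ^ ((2 * m : ℕ) : ℝ) ∂(bernoulliMeasure (1 - (x : ℝ)) (-(x : ℝ)) x) with hM
  have hMeq : M = (x : ℝ) * (1 - (x : ℝ)) ^ (2 * m) + (1 - (x : ℝ)) * (x : ℝ) ^ (2 * m) := by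
    rw [hM, integral_bernoulliMeasure]
    simp only [id, smul_eq_mul, Real.rpow_natCast,
      Even.pow_abs (even_two_mul m), Even.neg_pow (even_two_mul m)]
  have hM0 : 0 ≤ M := integral_nonneg fun _ => Real.rpow_nonneg (abs_nonneg _) _
  rw [← hMeq]
  have hq0 : (0 : ℝ) < (2 * m : ℕ) := by push_cast; linarith
  rw [Real.rpow_neg hq0.le, inv_mul_le_iff₀ (by positivity), ← Real.sqrt_eq_rpow] at h
  have h2 := pow_le_pow_left₀ (Real.rpow_nonneg hM0 _) h (2 * m)
  rw [← Real.rpow_natCast, ← Real.rpow_mul hM0, one_div_mul_cancel hq0.ne', Real.rpow_one,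
    mul_pow, pow_mul, Real.sq_sqrt hq0.le, pow_mul Q, ← mul_pow] at h2
  refine h2.trans (le_of_eq ?_)
  congr 1; push_cast; ring

/-! ### The law of a single measurement. -/

instance : IsProbabilityMeasure unifAngle := by
  refine cond_isProbabilityMeasure_of_finite ?_ ?_
  · simp [Real.pi_pos]
  · rw [Real.volume_Ico]; exact ENNReal.ofReal_ne_top

lemma integral_exp_unifAngle :
    ∫ x : ℝ, Complex.exp (Complex.I * (x : ℂ)) ∂unifAngle = 0 := by
  rw [unifAngle, ProbabilityTheory.cond, integral_smul_measure, integral_Ico_eq_integral_Ioc,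
    ← intervalIntegral.integral_of_le (by positivity), integral_exp_mul_complex Complex.I_ne_zero]
  have : Complex.exp (Complex.I * ((2 * Real.pi : ℝ) : ℂ)) = 1 := by
    push_cast
    rw [mul_comm]
    exact Complex.exp_two_pi_mul_I
  rw [this]
  simp

/-- The law of (edge, outlier, angle) for one pair. -/
noncomputable def pairLaw (p η : I) : Measure (Prop × Prop × ℝ) :=
  (bernoulliMeasure True False p).prod ((bernoulliMeasure True False η).prod unifAngle)

instance (p η : I) : IsProbabilityMeasure (pairLaw p η) := by
  unfold pairLaw; infer_instance

open Classical in
/-- One measurement as a function of (edge, outlier, angle) and of the true value `h`. -/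
noncomputable def measurement (h : ℂ) (y : Prop × Prop × ℝ) : ℂ :=
  if y.1 then if y.2.1 then Complex.exp (Complex.I * (y.2.2 : ℂ)) else h else 0

lemma measurable_measurement (h : ℂ) : Measurable (measurement h) := by
  unfold measurement
  refine Measurable.ite (measurableSet_setOfPred.2 measurable_fst) (Measurable.ite
    (measurableSet_setOfPred.2 (measurable_fst.comp measurable_snd)) ?_ measurable_const)
    measurable_const
  fun_prop

lemma norm_exp_I_mul_ofReal (x : ℝ) : ‖Complex.exp (Complex.I * (x : ℂ))‖ = 1 := by
  rw [mul_comm, Complex.norm_exp_ofReal_mul_I]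

lemma norm_measurement_le {h : ℂ} (hh : ‖h‖ = 1) (y : Prop × Prop × ℝ) :
    ‖measurement h y‖ ≤ 1 := by
  unfold measurement
  split_ifs
  · exact (norm_exp_I_mul_ofReal _).le
  · exact hh.le
  · simp

lemma integrable_measurement {h : ℂ} (hh : ‖h‖ = 1) (p η : I) :
    Integrable (measurement h) (pairLaw p η) :=
  Integrable.of_bound (measurable_measurement h).aestronglyMeasurable 1
    (Filter.Eventually.of_forall (norm_measurement_le hh))

/-- A uniform phase has mean zero, so only edges that are not outliers contribute, with weight (1 -
η)p. -/
lemma integral_measurement {h : ℂ} (hh : ‖h‖ = 1) (p η : I) :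
    ∫ y, measurement h y ∂(pairLaw p η) = (((1 - (η : ℝ)) * (p : ℝ) : ℝ) : ℂ) * h := by
  have hInt := integrable_measurement hh p η
  unfold pairLaw at hInt ⊢
  rw [integral_prod _ hInt, integral_bernoulliMeasure]
  have hint2 : Integrable (fun y : Prop × ℝ => measurement h (True, y))
      ((bernoulliMeasure True False η).prod unifAngle) :=
    Integrable.of_bound ((measurable_measurement h).comp
      measurable_prodMk_left).aestronglyMeasurable 1
      (Filter.Eventually.of_forall fun y => norm_measurement_le hh _)
  rw [integral_prod _ hint2, integral_bernoulliMeasure]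
  simp only [measurement, if_true, if_false, integral_exp_unifAngle]
  simp
  ring

open Classical in
-- Splits the noise into three parts matching the three summands of Q. The coefficient 2 comes from
-- an outlier edge, whose phase may oppose the mean: there the right side exceeds 1 + (1 - η)p by (1
-- - p)(2 - η), which is zero at p = 1.
lemma norm_measurement_sub_le {h : ℂ} (hh : ‖h‖ = 1) (p η : I) (y : Prop × Prop × ℝ) :
    ‖measurement h y - (((1 - (η : ℝ)) * (p : ℝ) : ℝ) : ℂ) * h‖ ≤
      |(if y.1 then (1 : ℝ) else 0) - p| + 2 * |(if y.2.1 then (1 : ℝ) else 0) - η| + η := by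
  have hp0 := p.2.1
  have hp1 := p.2.2
  have he0 := η.2.1
  have he1 := η.2.2
  have hd : 0 ≤ (1 - (η : ℝ)) * (p : ℝ) := mul_nonneg (by linarith) hp0
  have hnorm : ‖(((1 - (η : ℝ)) * (p : ℝ) : ℝ) : ℂ) * h‖ = (1 - (η : ℝ)) * (p : ℝ) := by
    rw [norm_mul, hh, mul_one, Complex.norm_real, Real.norm_of_nonneg hd]
  have a1 : |1 - (p : ℝ)| = 1 - p := abs_of_nonneg (by linarith)
  have a2 : |0 - (p : ℝ)| = p := by rw [zero_sub, abs_neg, abs_of_nonneg hp0]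
  have a3 : |1 - (η : ℝ)| = 1 - η := abs_of_nonneg (by linarith)
  have a4 : |0 - (η : ℝ)| = η := by rw [zero_sub, abs_neg, abs_of_nonneg he0]
  unfold measurement
  by_cases h1 : y.1
  · by_cases h2 : y.2.1
    · simp only [h1, h2, if_true]
      refine (norm_sub_le _ _).trans ?_
      rw [hnorm, norm_exp_I_mul_ofReal, a1, a3]
      nlinarith
    · simp only [h1, h2, if_true, if_false]
      have : h - (((1 - (η : ℝ)) * (p : ℝ) : ℝ) : ℂ) * h =
          ((1 - (1 - (η : ℝ)) * (p : ℝ) : ℝ) : ℂ) * h := by push_cast; ring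
      rw [this, norm_mul, hh, mul_one, Complex.norm_real,
        Real.norm_of_nonneg (by nlinarith), a1, a4]
      nlinarith
  · simp only [h1, if_false]
    rw [zero_sub, norm_neg, hnorm, a2]
    have := abs_nonneg ((if y.2.1 then (1 : ℝ) else 0) - η)
    nlinarith

lemma pow_add_le_sum_pow {x y z : ℝ} (hx : 0 ≤ x) (hy : 0 ≤ y) (hz : 0 ≤ z) (m : ℕ) :
    (x + 2 * y + z) ^ (2 * m) ≤ 16 ^ m * (x ^ (2 * m) + y ^ (2 * m) + z ^ (2 * m)) := by
  have h16 : (16 : ℝ) ^ m = 4 ^ (2 * m) := by rw [pow_mul]; norm_num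
  set M := max x (max y z) with hM
  have hxM : x ≤ M := le_max_left _ _
  have hyM : y ≤ M := (le_max_left _ _).trans (le_max_right _ _)
  have hzM : z ≤ M := (le_max_right _ _).trans (le_max_right _ _)
  have hpow : M ^ (2 * m) ≤ x ^ (2 * m) + y ^ (2 * m) + z ^ (2 * m) := by
    have h1 := pow_nonneg hx (2 * m)
    have h2 := pow_nonneg hy (2 * m)
    have h3 := pow_nonneg hz (2 * m)
    rcases max_choice x (max y z) with h | h
    · rw [hM, h]; linarith
    · rcases max_choice y z with h' | h'
      · rw [hM, h, h']; linarith
      · rw [hM, h, h']; linarith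
  calc (x + 2 * y + z) ^ (2 * m) ≤ (4 * M) ^ (2 * m) := by gcongr; linarith
    _ = 16 ^ m * M ^ (2 * m) := by rw [mul_pow, h16]
    _ ≤ _ := by gcongr

/-- Even moments of the centred measurement. -/
lemma integral_norm_measurement_sub_pow_le {h : ℂ} (hh : ‖h‖ = 1) (p η : I) {Q : ℝ}
    (hp : Qber p ≤ Q) (hη : Qber η ≤ Q) (hη' : (η : ℝ) ≤ Q) (m : ℕ) :
    ∫ y, ‖measurement h y - (((1 - (η : ℝ)) * (p : ℝ) : ℝ) : ℂ) * h‖ ^ (2 * m) ∂(pairLaw p η) ≤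
      (96 * Q ^ 2 * m) ^ m := by
  classical
  rcases Nat.eq_zero_or_pos m with rfl | hm
  · simp
  let f : I → Prop → ℝ := fun x a => |(if a then (1 : ℝ) else 0) - x| ^ (2 * m)
  have hf : ∀ x : I, Qber x ≤ Q →
      ∫ a, f x a ∂(bernoulliMeasure True False x) ≤ (2 * Q ^ 2 * m) ^ m := by
    intro x hx
    rw [integral_bernoulliMeasure]
    refine le_trans (le_of_eq ?_) (bernoulli_even_moment_le x hm hx)
    simp only [f, if_true, if_false, smul_eq_mul, Even.pow_abs (even_two_mul m), zero_sub,
      Even.neg_pow (even_two_mul m)]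
  have hfp := hf p hp
  have hfη := hf η hη
  have hpow : (η : ℝ) ^ (2 * m) ≤ (2 * Q ^ 2 * m) ^ m := by
    have hη0 : (0 : ℝ) ≤ η := η.2.1
    have hm' : (1 : ℝ) ≤ m := by exact_mod_cast hm
    rw [pow_mul]
    gcongr
    nlinarith [pow_le_pow_left₀ hη0 hη' 2, sq_nonneg Q]
  have hi1 : Integrable (fun y : Prop × Prop × ℝ => f p y.1) (pairLaw p η) :=
    (integrable_bernoulliMeasure True False p (f p)).comp_fst _
  have hi2 : Integrable (fun y : Prop × Prop × ℝ => f η y.2.1) (pairLaw p η) :=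
    ((integrable_bernoulliMeasure True False η (f η)).comp_fst unifAngle).comp_snd _
  -- The constant is 96 = 16 · 3 · 2: 16 from splitting the power, 3 from the number of terms, 2
  -- from the Bernoulli moments.
  calc _ ≤ ∫ y, (16 : ℝ) ^ m * (f p y.1 + f η y.2.1 + (η : ℝ) ^ (2 * m)) ∂(pairLaw p η) := by
        refine integral_mono_of_nonneg (Filter.Eventually.of_forall fun y => by positivity)
          (((hi1.add hi2).add (integrable_const _)).const_mul _)
          (Filter.Eventually.of_forall fun y => ?_)
        exact (pow_le_pow_left₀ (norm_nonneg _) (norm_measurement_sub_le hh p η y) _).trans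
          (pow_add_le_sum_pow (abs_nonneg _) (abs_nonneg _) η.2.1 m)
    _ = 16 ^ m * (∫ a, f p a ∂(bernoulliMeasure True False p) +
          ∫ a, f η a ∂(bernoulliMeasure True False η) + (η : ℝ) ^ (2 * m)) := by
        rw [integral_const_mul, integral_add (f := fun y : Prop × Prop × ℝ => f p y.1 + f η y.2.1)
          (hi1.add hi2) (integrable_const _), integral_add hi1 hi2]
        unfold pairLaw
        rw [integral_fun_fst (f p), integral_fun_snd (fun y : Prop × ℝ => f η y.1),
          integral_fun_fst (f η)]
        simp
    _ ≤ 16 ^ m * ((2 * Q ^ 2 * m) ^ m + (2 * Q ^ 2 * m) ^ m + (2 * Q ^ 2 * m) ^ m) := by gcongr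
    _ = 16 ^ m * (3 * (2 * Q ^ 2 * m) ^ m) := by ring
    _ ≤ 16 ^ m * (3 ^ m * (2 * Q ^ 2 * m) ^ m) := by
        gcongr
        exact le_self_pow₀ (by norm_num) hm.ne'
    _ = _ := by rw [← mul_pow, ← mul_pow]; congr 1; ring

/-! ### Concentration of the noise -/

section Noise

variable {Ω : Type*} {n T : ℕ} {η : I} {p : Fin T → I} {H : Fin T → Ω → SimpleGraph (Fin n)}
  {outlier : PairIdx n T → Ω → Prop} {φ : PairIdx n T → Ω → ℝ} {g : Fin T → Fin n → ℂ}
  (ψ : ℂ →L[ℝ] ℝ) (v : OrthonormalBasis (Fin T) ℝ (EuclideanSpace ℝ (Fin T)))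

/-- The noise-free measurement of a pair. -/
noncomputable def trueObs (g : Fin T → Fin n → ℂ) (e : PairIdx n T) : ℂ :=
  g e.1 e.2.1.1 * star (g e.1 e.2.1.2)

lemma norm_trueObs (hg : ∀ k i, ‖g k i‖ = 1) (e : PairIdx n T) : ‖trueObs g e‖ = 1 := by
  rw [trueObs, norm_mul, norm_star, hg, hg, one_mul]

/-- The centred measurement as a function of (edge, outlier, angle). -/
noncomputable def centredMeasurement (g : Fin T → Fin n → ℂ) (η : I) (p : Fin T → I)
    (e : PairIdx n T) (y : Prop × Prop × ℝ) : ℂ :=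
  measurement (trueObs g e) y - (((1 - (η : ℝ)) * (p e.1 : ℝ) : ℝ) : ℂ) * trueObs g e

/-- The triple (edge, outlier, angle) of a pair. -/
def ingredients (H : Fin T → Ω → SimpleGraph (Fin n)) (outlier : PairIdx n T → Ω → Prop)
    (φ : PairIdx n T → Ω → ℝ) (e : PairIdx n T) (ω : Ω) : Prop × Prop × ℝ :=
  ((H e.1 ω).Adj e.2.1.1 e.2.1.2, outlier e ω, φ e ω)

lemma norm_centredMeasurement_le (hg : ∀ k i, ‖g k i‖ = 1) (e : PairIdx n T)
    (y : Prop × Prop × ℝ) : ‖centredMeasurement g η p e y‖ ≤ 2 := by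
  have hp0 := (p e.1).2.1
  have hp1 := (p e.1).2.2
  have he0 := η.2.1
  have he1 := η.2.2
  refine (norm_sub_le _ _).trans ?_
  have h1 := norm_measurement_le (norm_trueObs hg e) y
  rw [norm_mul, norm_trueObs hg, mul_one, Complex.norm_real,
    Real.norm_of_nonneg (mul_nonneg (by linarith) hp0)]
  nlinarith

/-- The noise of a pair, as a sequence in time. -/
noncomputable def noiseSeq (g : Fin T → Fin n → ℂ) (η : I) (p : Fin T → I)
    (H : Fin T → Ω → SimpleGraph (Fin n)) (outlier : PairIdx n T → Ω → Prop)
    (φ : PairIdx n T → Ω → ℝ) (q : {q : Fin n × Fin n // q.1 < q.2}) (ω : Ω) (k : Fin T) : ℂ :=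
  centredMeasurement g η p (k, q) (ingredients H outlier φ (k, q) ω)

/-- ψ will be the real or the imaginary part; it commutes with taking coefficients because the basis
is real. -/
lemma map_coef (z : Fin T → ℂ) (l : Fin T) : ψ (coef v z l) = ∑ k, v l k * ψ (z k) := by
  rw [coef, map_sum]
  refine Finset.sum_congr rfl fun k _ => ?_
  rw [← Complex.real_smul, map_smul, smul_eq_mul]

/-- A crude bound, used only for integrability. -/
lemma abs_coef_noise_le (hg : ∀ k i, ‖g k i‖ = 1) (hψ : ∀ z, |ψ z| ≤ ‖z‖)
    (q : {q : Fin n × Fin n // q.1 < q.2}) (l : Fin T) (ω : Ω) :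
    |ψ (coef v (noiseSeq g η p H outlier φ q ω) l)| ≤ ∑ k, |v l k| * 2 := by
  rw [map_coef]
  refine (Finset.abs_sum_le_sum_abs _ _).trans (Finset.sum_le_sum fun k _ => ?_)
  rw [abs_mul]
  gcongr
  exact (hψ _).trans (norm_centredMeasurement_le hg _ _)

/-- The centred observations `A - D Ḡ`. -/
noncomputable def residual (g : Fin T → Fin n → ℂ) (η : I) (p : Fin T → I)
    (H : Fin T → Ω → SimpleGraph (Fin n)) (outlier : PairIdx n T → Ω → Prop)
    (φ : PairIdx n T → Ω → ℝ) (ω : Ω) : Matrix (Fin T × Fin n) (Fin n) ℂ :=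
  obs g H outlier φ ω - Dmat n η p * Gbar g

lemma Dmat_mul_Gbar_apply (k : Fin T) (i j : Fin n) :
    (Dmat n η p * Gbar g) (k, i) j =
      (((1 - (η : ℝ)) * (p k : ℝ) : ℝ) : ℂ) *
        (g k i * star (g k j) - (1 : Matrix (Fin n) (Fin n) ℂ) i j) := by
  rw [Dmat, Matrix.diagonal_mul]
  rfl

lemma residual_of_lt {i j : Fin n} (h : i < j) (k : Fin T) (ω : Ω) :
    residual g η p H outlier φ ω (k, i) j = noiseSeq g η p H outlier φ ⟨(i, j), h⟩ ω k := by
  rw [residual, Matrix.sub_apply, Dmat_mul_Gbar_apply, Matrix.one_apply_ne h.ne, sub_zero]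
  simp only [obs, Matrix.of_apply, dif_pos h]
  rfl

/-- By Hermitian symmetry the two triangles carry the same noise up to conjugation, so entries are
dependent and the tail bound must tolerate this. -/
lemma residual_of_gt {i j : Fin n} (h : j < i) (k : Fin T) (ω : Ω) :
    residual g η p H outlier φ ω (k, i) j =
      star (noiseSeq g η p H outlier φ ⟨(j, i), h⟩ ω k) := by
  rw [← residual_of_lt h, residual, Matrix.sub_apply, Matrix.sub_apply, Dmat_mul_Gbar_apply,
    Dmat_mul_Gbar_apply, Matrix.one_apply_ne h.ne, Matrix.one_apply_ne h.ne', sub_zero, sub_zero,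
    star_sub]
  simp only [obs, Matrix.of_apply, dif_pos h, dif_neg h.not_gt, star_mul', star_star]
  congr 1
  rw [mul_comm (g k i)]
  simp

/-- Unit modulus makes the diagonal of g gᴴ - I vanish, matching the zero diagonal of A. -/
lemma residual_diag (hg : ∀ k i, ‖g k i‖ = 1) (i : Fin n) (k : Fin T) (ω : Ω) :
    residual g η p H outlier φ ω (k, i) i = 0 := by
  rw [residual, Matrix.sub_apply, Dmat_mul_Gbar_apply, Matrix.one_apply_eq]
  have : g k i * star (g k i) = 1 := by
    have := Complex.mul_conj (g k i)
    rw [Complex.normSq_eq_norm_sq, hg] at this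
    simpa using this
  rw [this]
  simp [obs]

lemma coef_star (z : Fin T → ℂ) (l : Fin T) :
    coef v (fun k => star (z k)) l = star (coef v z l) := by
  simp [coef]

/-- The squared norm of the projected noise. -/
noncomputable def noiseSq (g : Fin T → Fin n → ℂ) (η : I) (p : Fin T → I)
    (H : Fin T → Ω → SimpleGraph (Fin n)) (outlier : PairIdx n T → Ω → Prop)
    (φ : PairIdx n T → Ω → ℝ) (τ : ℕ) (ω : Ω) : ℝ :=
  ∑ i, ∑ j, ∑ l ∈ lowIdx T τ, ‖coef v (fun k => residual g η p H outlier φ ω (k, i) j) l‖ ^ 2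

variable [MeasurableSpace Ω] {P : Measure Ω}

lemma measurable_centredMeasurement (e : PairIdx n T) :
    Measurable (centredMeasurement g η p e) :=
  (measurable_measurement _).sub_const _

lemma measurable_ingredients (hM : IsOutliersModel P η p H outlier φ) (e : PairIdx n T) :
    Measurable (ingredients H outlier φ e) :=
  (hM.measurable_adj e).prodMk ((hM.measurable_outlier e).prodMk (hM.measurable_angle e))

lemma map_ingredients (hM : IsOutliersModel P η p H outlier φ) (e : PairIdx n T) :
    P.map (ingredients H outlier φ e) = pairLaw (p e.1) η := hM.law e

lemma measurable_coef_noise (hM : IsOutliersModel P η p H outlier φ)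
    (q : {q : Fin n × Fin n // q.1 < q.2}) (l : Fin T) :
    Measurable fun ω => ψ (coef v (noiseSeq g η p H outlier φ q ω) l) := by
  simp_rw [map_coef]
  exact Finset.measurable_sum _ fun k _ => (ψ.continuous.measurable.comp
    ((measurable_centredMeasurement _).comp (measurable_ingredients hM _))).const_mul _

variable [IsProbabilityMeasure P]

lemma Qber_le_Qtot (k : Fin T) : Qber (p k) ≤ Qtot η p := by
  have h := le_ciSup (f := fun k => Qber (p k)) (Set.finite_range _).bddAbove k
  have := η.2.1
  have := Qber_nonneg η
  unfold Qtot; linarith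

lemma iSup_Qber_nonneg : 0 ≤ ⨆ k, Qber (p k) := Real.iSup_nonneg fun _ => Qber_nonneg _

lemma Qber_outlier_le_Qtot : Qber η ≤ Qtot η p := by
  have := η.2.1
  have := iSup_Qber_nonneg (p := p)
  unfold Qtot; linarith

lemma outlier_le_Qtot : (η : ℝ) ≤ Qtot η p := by
  have := Qber_nonneg η
  have := iSup_Qber_nonneg (p := p)
  unfold Qtot; linarith

lemma Qtot_nonneg : 0 ≤ Qtot η p := η.2.1.trans outlier_le_Qtot

/-- A real component of the noise of a pair is sub-Gaussian. -/
lemma hasSubgaussianMGF_noise (hM : IsOutliersModel P η p H outlier φ)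
    (hg : ∀ k i, ‖g k i‖ = 1) (hψ : ∀ z, |ψ z| ≤ ‖z‖) {Q : ℝ} (hQ0 : 0 < Q)
    (hQ : Qtot η p ≤ Q) (e : PairIdx n T) :
    HasSubgaussianMGF (fun ω => ψ (centredMeasurement g η p e (ingredients H outlier φ e ω)))
      (5 * (96 * Q ^ 2) * Real.exp 1).toNNReal P := by
  have hmi := measurable_ingredients hM e
  have hmc : Measurable (centredMeasurement g η p e) := measurable_centredMeasurement e
  have hlaw := map_ingredients hM e
  have hmψ : Measurable fun y => ψ (centredMeasurement g η p e y) :=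
    ψ.continuous.measurable.comp hmc
  refine hasSubgaussianMGF_of_moments (B := 2) (hmψ.comp hmi)
    (fun ω => (hψ _).trans (norm_centredMeasurement_le hg e _)) (by positivity) ?_ fun m => ?_
  · have hInt : Integrable (centredMeasurement g η p e) (pairLaw (p e.1) η) :=
      (integrable_measurement (norm_trueObs hg e) _ _).sub (integrable_const _)
    rw [← integral_map hmi.aemeasurable hmψ.aestronglyMeasurable, hlaw,
      ψ.integral_comp_comm hInt]
    unfold centredMeasurement
    rw [integral_sub (integrable_measurement (norm_trueObs hg e) _ _) (integrable_const _),
      integral_measurement (norm_trueObs hg e)]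
    simp
  · rw [← integral_map (f := fun y => ψ (centredMeasurement g η p e y) ^ (2 * m))
      hmi.aemeasurable (hmψ.pow_const _).aestronglyMeasurable, hlaw]
    refine le_trans ?_ (integral_norm_measurement_sub_pow_le (norm_trueObs hg e) (p e.1) η
      ((Qber_le_Qtot e.1).trans hQ) (Qber_outlier_le_Qtot.trans hQ) (outlier_le_Qtot.trans hQ) m)
    refine integral_mono_of_nonneg
      (Filter.Eventually.of_forall fun y => (even_two_mul m).pow_nonneg _)
      (Integrable.of_bound (C := 2 ^ (2 * m)) (hmc.norm.pow_const _).aestronglyMeasurable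
        (Filter.Eventually.of_forall fun y => ?_)) (Filter.Eventually.of_forall fun y => ?_)
    · rw [Real.norm_of_nonneg (by positivity)]
      exact pow_le_pow_left₀ (norm_nonneg _) (norm_centredMeasurement_le hg e y) _
    · dsimp only
      rw [← Even.pow_abs (even_two_mul m)]
      exact pow_le_pow_left₀ (abs_nonneg _) (hψ _) _

/-- For a fixed pair the noise is independent over time, so variance proxies add with weights
v_l(k)², whose sum is 1. -/
lemma hasSubgaussianMGF_coef_noise (hM : IsOutliersModel P η p H outlier φ)
    (hg : ∀ k i, ‖g k i‖ = 1) (hψ : ∀ z, |ψ z| ≤ ‖z‖) {Q : ℝ} (hQ0 : 0 < Q)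
    (hQ : Qtot η p ≤ Q) (q : {q : Fin n × Fin n // q.1 < q.2}) (l : Fin T) :
    HasSubgaussianMGF (fun ω => ψ (coef v (noiseSeq g η p H outlier φ q ω) l))
      (5 * (96 * Q ^ 2) * Real.exp 1).toNNReal P := by
  set c := (5 * (96 * Q ^ 2) * Real.exp 1).toNNReal with hc
  simp_rw [map_coef]
  have hind : iIndepFun (fun k ω => v l k * ψ (noiseSeq g η p H outlier φ q ω k)) P := by
    have h1 : iIndepFun (fun (k : Fin T) => ingredients H outlier φ (k, q)) P :=
      hM.indep.precomp (g := fun k : Fin T => (k, q)) fun a b h => congrArg Prod.fst h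
    exact h1.comp (fun k y => v l k * ψ (centredMeasurement g η p (k, q) y)) fun k =>
      (ψ.continuous.measurable.comp (measurable_centredMeasurement _)).const_mul _
  have hsub := HasSubgaussianMGF.sum_of_iIndepFun hind (s := Finset.univ)
    (fun k _ => (hasSubgaussianMGF_noise ψ hM hg hψ hQ0 hQ (k, q)).const_mul (v l k))
  convert hsub using 1
  ext
  rw [NNReal.coe_sum]
  change (c : ℝ) = ∑ k, v l k ^ 2 * (c : ℝ)
  rw [← Finset.sum_mul]
  have := sum_mul_eq_ite v l l
  simp only [← sq, if_true] at this
  rw [this, one_mul]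

/-- The scale at which squared noise coefficients have exponential moments. -/
noncomputable def expScale (Q : ℝ) : ℝ := 1 / (3840 * Real.exp 1 ^ 3 * Q ^ 2)

lemma integral_exp_sq_coef_noise_le (hM : IsOutliersModel P η p H outlier φ)
    (hg : ∀ k i, ‖g k i‖ = 1) (hψ : ∀ z, |ψ z| ≤ ‖z‖) {Q : ℝ} (hQ0 : 0 < Q)
    (hQ : Qtot η p ≤ Q) (q : {q : Fin n × Fin n // q.1 < q.2}) (l : Fin T) :
    Integrable (fun ω => Real.exp
      (expScale Q * ψ (coef v (noiseSeq g η p H outlier φ q ω) l) ^ 2)) P ∧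
    ∫ ω, Real.exp (expScale Q * ψ (coef v (noiseSeq g η p H outlier φ q ω) l) ^ 2) ∂P ≤ 2 := by
  have hm := measurable_coef_noise (g := g) ψ v hM q l
  have hb := abs_coef_noise_le (η := η) (p := p) (H := H) (outlier := outlier) (φ := φ) ψ v hg hψ
    q l
  refine ⟨integrable_exp_mul_sq hm hb _, ?_⟩
  have hsub := hasSubgaussianMGF_coef_noise ψ v hM hg hψ hQ0 hQ q l
  have hpos : 0 < 5 * (96 * Q ^ 2) * Real.exp 1 := by positivity
  have hmom := integral_even_pow_le_of_hasSubgaussianMGF (Real.toNNReal_pos.2 hpos) hsub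
  rw [Real.coe_toNNReal _ hpos.le] at hmom
  -- `expScale` is chosen to make this product exactly 1/2, so that the exponential moment is at
  -- most 2: 3840 = 2 · 4 · 5 · 96.
  have hs : expScale Q * (4 * Real.exp 1 * (5 * (96 * Q ^ 2) * Real.exp 1)) * Real.exp 1
      = 1 / 2 := by
    unfold expScale; field_simp; norm_num
  have := integral_exp_mul_sq_le hm hb (by positivity) hmom (s := expScale Q)
    (by unfold expScale; positivity) hs.le
  rw [hs] at this
  linarith

/-- The real part (`true`) or the imaginary part (`false`). -/
noncomputable def component (b : Bool) : ℂ →L[ℝ] ℝ := if b then Complex.reCLM else Complex.imCLM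

lemma abs_component_le (b : Bool) (z : ℂ) : |component b z| ≤ ‖z‖ := by
  cases b
  · exact Complex.abs_im_le_norm z
  · exact Complex.abs_re_le_norm z

lemma component_star_sq (b : Bool) (z : ℂ) : component b (star z) ^ 2 = component b z ^ 2 := by
  cases b <;> simp [component]

lemma norm_sq_eq_sum_component (z : ℂ) : ‖z‖ ^ 2 = ∑ b, component b z ^ 2 := by
  rw [norm_sq_eq_re_add_im, Fintype.sum_bool]; rfl

lemma integral_exp_sq_coef_residual_le (hM : IsOutliersModel P η p H outlier φ)
    (hg : ∀ k i, ‖g k i‖ = 1) {Q : ℝ} (hQ0 : 0 < Q) (hQ : Qtot η p ≤ Q) (b : Bool)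
    (i j : Fin n) (l : Fin T) :
    Integrable (fun ω => Real.exp (expScale Q *
      component b (coef v (fun k => residual g η p H outlier φ ω (k, i) j) l) ^ 2)) P ∧
    ∫ ω, Real.exp (expScale Q *
      component b (coef v (fun k => residual g η p H outlier φ ω (k, i) j) l) ^ 2) ∂P ≤ 2 := by
  rcases lt_trichotomy i j with h | rfl | h
  · simp_rw [residual_of_lt h]
    exact integral_exp_sq_coef_noise_le _ v hM hg (abs_component_le b) hQ0 hQ _ l
  · simp_rw [residual_diag hg]
    simp [coef]
  · simp_rw [residual_of_gt h, coef_star, component_star_sq]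
    exact integral_exp_sq_coef_noise_le _ v hM hg (abs_component_le b) hQ0 hQ _ l

/-- A majorant Q > 0 replaces `Qtot` because the scale `expScale` and the sub-Gaussian lemmas need a
positive parameter, while `Qtot` may vanish. The constant is 15360 = 2 · 2 · 3840: real and
imaginary parts, and log(2/δ) ≤ 2 log(1/δ) for δ < 1/2. -/
lemma noiseSq_tail_of_le (hM : IsOutliersModel P η p H outlier φ)
    (hg : ∀ k i, ‖g k i‖ = 1) {Q : ℝ} (hQ0 : 0 < Q) (hQ : Qtot η p ≤ Q) {δ : ℝ} (hδ : 0 < δ)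
    (hδ' : δ < 1 / 2) (τ : ℕ) :
    P.real {ω | 15360 * Real.exp 1 ^ 3 * (n : ℝ) ^ 2 * τ * Q ^ 2 * Real.log (1 / δ) <
      noiseSq v g η p H outlier φ τ ω} ≤ δ := by
  let A : Finset ((Fin n × Fin n) × Fin T × Bool) :=
    Finset.univ ×ˢ (lowIdx T τ ×ˢ Finset.univ)
  let X : (Fin n × Fin n) × Fin T × Bool → Ω → ℝ := fun a ω =>
    component a.2.2 (coef v (fun k => residual g η p H outlier φ ω (k, a.1.1) a.1.2) a.2.1)
  have hs : 0 < expScale Q := by unfold expScale; positivity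
  have htail := measureReal_sum_sq_gt_le (P := P) A X hs hδ
    (fun a _ => (integral_exp_sq_coef_residual_le v hM hg hQ0 hQ a.2.2 a.1.1 a.1.2 a.2.1).1)
    (fun a _ => (integral_exp_sq_coef_residual_le v hM hg hQ0 hQ a.2.2 a.1.1 a.1.2 a.2.1).2)
  refine (measureReal_mono ?_).trans htail
  intro ω hω
  have hω' : 15360 * Real.exp 1 ^ 3 * (n : ℝ) ^ 2 * τ * Q ^ 2 * Real.log (1 / δ) <
      noiseSq v g η p H outlier φ τ ω := hω
  have hsum : ∑ a ∈ A, X a ω ^ 2 = noiseSq v g η p H outlier φ τ ω := by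
    simp only [A, X, Finset.sum_product, Fintype.sum_prod_type, noiseSq, norm_sq_eq_sum_component]
  have hcard : (A.card : ℝ) ≤ 2 * (n : ℝ) ^ 2 * τ := by
    have : A.card = n * n * ((lowIdx T τ).card * 2) := by simp [A, Finset.card_product]
    rw [this]
    have hl : ((lowIdx T τ).card : ℝ) ≤ τ := by exact_mod_cast card_lowIdx_le T τ
    push_cast
    calc (n : ℝ) * n * ((lowIdx T τ).card * 2) ≤ n * n * (τ * 2) := by gcongr
      _ = _ := by ring
  have hlog2 : Real.log 2 ≤ Real.log (1 / δ) :=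
    Real.log_le_log (by norm_num) (by rw [le_div_iff₀ hδ]; linarith)
  have hlog : Real.log (2 / δ) ≤ 2 * Real.log (1 / δ) := by
    rw [show 2 / δ = 2 * (1 / δ) by ring, Real.log_mul (by norm_num) (by positivity)]
    linarith
  have hlog0 : 0 ≤ Real.log (2 / δ) / expScale Q :=
    div_nonneg (Real.log_nonneg (by rw [le_div_iff₀ hδ]; linarith)) hs.le
  change (A.card : ℝ) * (Real.log (2 / δ) / expScale Q) < ∑ a ∈ A, X a ω ^ 2
  rw [hsum]
  refine lt_of_le_of_lt ?_ hω'
  calc (A.card : ℝ) * (Real.log (2 / δ) / expScale Q)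
      ≤ (2 * (n : ℝ) ^ 2 * τ) * (2 * Real.log (1 / δ) / expScale Q) := by gcongr
    _ = _ := by unfold expScale; field_simp; ring

/-- If `Qtot` is zero, the bound is applied with Q = 1/(m+1); these events increase with m, and
continuity of the measure passes the bound δ to their union. -/
lemma noiseSq_tail (hM : IsOutliersModel P η p H outlier φ)
    (hg : ∀ k i, ‖g k i‖ = 1) {δ : ℝ} (hδ : 0 < δ) (hδ' : δ < 1 / 2) (τ : ℕ) :
    P.real {ω | 15360 * Real.exp 1 ^ 3 * (n : ℝ) ^ 2 * τ * Qtot η p ^ 2 * Real.log (1 / δ) <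
      noiseSq v g η p H outlier φ τ ω} ≤ δ := by
  rcases (Qtot_nonneg (η := η) (p := p)).lt_or_eq with hQ | hQ
  · exact noiseSq_tail_of_le v hM hg hQ le_rfl hδ hδ' τ
  set V := noiseSq v g η p H outlier φ τ with hV
  set a := 15360 * Real.exp 1 ^ 3 * (n : ℝ) ^ 2 * τ with ha
  have hlog : 0 < Real.log (1 / δ) :=
    Real.log_pos (by rw [lt_div_iff₀ hδ]; linarith)
  have ha0 : 0 ≤ a := by positivity
  let r : ℕ → ℝ := fun m => 1 / ((m : ℝ) + 1)
  have hr : ∀ m, 0 < r m := fun m => by positivity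
  have hmono : Monotone fun m => {ω | a * r m ^ 2 * Real.log (1 / δ) < V ω} := by
    intro m m' hmm ω hω
    have hω' : a * r m ^ 2 * Real.log (1 / δ) < V ω := hω
    have : r m' ≤ r m := one_div_le_one_div_of_le (by positivity) (by gcongr)
    refine lt_of_le_of_lt ?_ hω'
    have := (hr m').le
    gcongr
  have hunion : {ω | a * Qtot η p ^ 2 * Real.log (1 / δ) < V ω} ⊆
      ⋃ m, {ω | a * r m ^ 2 * Real.log (1 / δ) < V ω} := by
    intro ω hω
    have hω' : a * Qtot η p ^ 2 * Real.log (1 / δ) < V ω := hω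
    rw [← hQ] at hω'
    have hlim : Filter.Tendsto (fun m => a * r m ^ 2 * Real.log (1 / δ)) Filter.atTop
        (nhds (a * 0 ^ 2 * Real.log (1 / δ))) :=
      ((tendsto_one_div_add_atTop_nhds_zero_nat.pow 2).const_mul a).mul_const _
    obtain ⟨m, hm⟩ := (hlim.eventually (gt_mem_nhds hω')).exists
    exact Set.mem_iUnion.2 ⟨m, hm⟩
  refine (measureReal_mono hunion).trans ?_
  rw [measureReal_def, hmono.measure_iUnion]
  refine ENNReal.toReal_le_of_le_ofReal hδ.le (iSup_le fun m => ?_)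
  rw [ENNReal.le_ofReal_iff_toReal_le (measure_ne_top _ _) hδ.le]
  exact noiseSq_tail_of_le v hM hg (hr m) (hQ.symm.le.trans (hr m).le) hδ hδ' τ

end Noise

/-! ### The bounds -/

section Bounds

variable {n T : ℕ} {η : I} {p : Fin T → I} {g : Fin T → Fin n → ℂ} {μ S δ : ℝ}

lemma SignalSmooth.nonneg (hS : SignalSmooth g S) : 0 ≤ S :=
  le_trans (Finset.sum_nonneg fun _ _ => Finset.sum_nonneg fun _ _ => sq_nonneg _) hS

lemma fVar_nonneg : 0 ≤ fVar η p := by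
  have h1 : 0 ≤ pMax p := Real.iSup_nonneg fun k => (p k).2.1
  have h2 : 0 ≤ Vmax p := Real.iSup_nonneg fun k =>
    mul_nonneg (p k).2.1 (sub_nonneg.2 (p k).2.2)
  have h3 : (0 : ℝ) ≤ η := η.2.1
  have h4 : (0 : ℝ) ≤ 1 - η := sub_nonneg.2 η.2.2
  unfold fVar
  positivity

lemma log_one_div_nonneg (hδ : 0 < δ) (hδ' : δ < 1 / 2) : 0 ≤ Real.log (1 / δ) :=
  Real.log_nonneg (by rw [le_div_iff₀ hδ]; linarith)

lemma Qtot_sq_mul_log_le : Qtot η p ^ 2 * Real.log (1 / δ) ≤ fTilde η p δ := by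
  have := fVar_nonneg (η := η) (p := p)
  unfold fTilde; linarith

lemma fTilde_nonneg (hδ : 0 < δ) (hδ' : δ < 1 / 2) : 0 ≤ fTilde η p δ := by
  have := log_one_div_nonneg hδ hδ'
  exact le_trans (by positivity) Qtot_sq_mul_log_le

lemma ratio_nonneg (hμ : 1 ≤ μ) (hS : 0 ≤ S) (hδ : 0 < δ) (hδ' : δ < 1 / 2) :
    0 ≤ ratio n η p μ S δ := by
  have := fTilde_nonneg (η := η) (p := p) hδ hδ'
  unfold ratio
  positivity

lemma one_le_tauStar (hT : 1 ≤ T) : 1 ≤ tauStar n η p μ S δ := by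
  unfold tauStar
  split_ifs
  · exact hT
  · exact le_min (by omega) hT

lemma tauStar_le : tauStar n η p μ S δ ≤ T := by
  unfold tauStar
  split_ifs
  · exact le_rfl
  · exact min_le_right _ _

/-- When τ* < T the minimum is attained by 1 + ⌊ρ^{1/3}⌋, which exceeds ρ^{1/3} and is at least 1.
-/
lemma one_add_ratio_rpow_le_of_tauStar_lt (hρ : 0 ≤ ratio n η p μ S δ)
    (h : tauStar n η p μ S δ < T) :
    1 + ratio n η p μ S δ ^ (2 / 3 : ℝ) ≤ 2 * (tauStar n η p μ S δ : ℝ) ^ 2 := by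
  have hdef : tauStar n η p μ S δ = 1 + ⌊ratio n η p μ S δ ^ (1 / 3 : ℝ)⌋₊ := by
    unfold tauStar at h ⊢
    split_ifs at h ⊢ with hf
    · exact absurd h (lt_irrefl _)
    · rcases min_choice (1 + ⌊ratio n η p μ S δ ^ (1 / 3 : ℝ)⌋₊) T with h' | h'
      · exact h'
      · rw [h'] at h; exact absurd h (lt_irrefl _)
  have hr : ratio n η p μ S δ ^ (2 / 3 : ℝ) = (ratio n η p μ S δ ^ (1 / 3 : ℝ)) ^ 2 := by
    rw [← Real.rpow_natCast, ← Real.rpow_mul hρ]; norm_num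
  have hx := Nat.lt_floor_add_one (ratio n η p μ S δ ^ (1 / 3 : ℝ))
  have hx0 := Real.rpow_nonneg hρ (1 / 3 : ℝ)
  rw [hr, hdef]
  push_cast
  have hfl : (0 : ℝ) ≤ ⌊ratio n η p μ S δ ^ (1 / 3 : ℝ)⌋₊ := Nat.cast_nonneg _
  nlinarith

/-- The case f̃ = 0 must be excluded: division by zero then makes `ratio` equal to 0, while τ* is T.
-/
lemma tauStar_le_min (hρ : 0 ≤ ratio n η p μ S δ) (hf : fTilde η p δ ≠ 0) :
    (tauStar n η p μ S δ : ℝ) ≤ min (1 + ratio n η p μ S δ ^ (1 / 3 : ℝ)) T := by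
  refine le_min ?_ (by exact_mod_cast tauStar_le)
  rw [tauStar, if_neg hf]
  have h1 := Nat.floor_le (Real.rpow_nonneg hρ (1 / 3 : ℝ))
  have h2 : ((min (1 + ⌊ratio n η p μ S δ ^ (1 / 3 : ℝ)⌋₊) T : ℕ) : ℝ) ≤
      (1 + ⌊ratio n η p μ S δ ^ (1 / 3 : ℝ)⌋₊ : ℕ) := by exact_mod_cast min_le_left _ _
  push_cast at h2 ⊢
  linarith

lemma frobSq_one_sub_proj_full (v : OrthonormalBasis (Fin T) ℝ (EuclideanSpace ℝ (Fin T)))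
    (Y : Matrix (Fin T × Fin n) (Fin n) ℂ) : frobSq ((1 - proj v T n) * Y) = 0 := by
  rw [frobSq_one_sub_proj_mul]
  exact Finset.sum_eq_zero fun i _ => Finset.sum_eq_zero fun j _ => Finset.sum_eq_zero fun l _ =>
    if_pos (mem_lowIdx.2 (by omega))

/-- The bias at the chosen number of frequencies. -/
lemma bias_le {lam : Fin T → ℝ} {v : OrthonormalBasis (Fin T) ℝ (EuclideanSpace ℝ (Fin T))}
    (hT : 1 ≤ T) (hg : ∀ k i, ‖g k i‖ = 1) (hS : SignalSmooth g S)
    (hv : IsSortedEigenbasis lam v) (hμ : 1 ≤ μ) (hD : DSmooth v g η p μ) (hδ : 0 < δ)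
    (hδ' : δ < 1 / 2) :
    frobSq ((1 - proj v (tauStar n η p μ S δ) n) * (Dmat n η p * Gbar g)) ≤
      if tauStar n η p μ S δ < T then
        32 * max (μ * dBar η p ^ 2 * n * (T : ℝ) ^ 2 * S /
          (1 + (ratio n η p μ S δ) ^ (2 / 3 : ℝ))) (μ * dBar η p ^ 2 * n * S)
      else 0 := by
  have hS0 := hS.nonneg
  have hρ := ratio_nonneg (n := n) (η := η) (p := p) hμ hS0 hδ hδ'
  split_ifs with h
  · have hτ := one_le_tauStar (n := n) (η := η) (p := p) (μ := μ) (S := S) (δ := δ) hT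
    have hτ' : (0 : ℝ) < tauStar n η p μ S δ := by exact_mod_cast hτ
    have hle := one_add_ratio_rpow_le_of_tauStar_lt hρ h
    have hρ' := Real.rpow_nonneg hρ (2 / 3 : ℝ)
    calc _ ≤ μ * dBar η p ^ 2 * frobSq ((1 - proj v (tauStar n η p μ S δ) n) * Gbar g) :=
          hD _ hτ tauStar_le
      _ ≤ μ * dBar η p ^ 2 *
            (16 * n * (T : ℝ) ^ 2 * S / (tauStar n η p μ S δ : ℝ) ^ 2) := by
          gcongr
          exact frobSq_one_sub_proj_mul_Gbar_le hg hS hv hτ hT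
      -- 32 = 16 · 2, the 2 preparing the comparison 1 + ρ^{2/3} ≤ 2τ*².
      _ = 32 * (μ * dBar η p ^ 2 * n * (T : ℝ) ^ 2 * S /
            (2 * (tauStar n η p μ S δ : ℝ) ^ 2)) := by field_simp; ring
      _ ≤ 32 * (μ * dBar η p ^ 2 * n * (T : ℝ) ^ 2 * S /
            (1 + (ratio n η p μ S δ) ^ (2 / 3 : ℝ))) := by gcongr
      _ ≤ _ := by gcongr; exact le_max_left _ _
  · have : tauStar n η p μ S δ = T := le_antisymm tauStar_le (not_lt.1 h)
    rw [this, frobSq_one_sub_proj_full]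

lemma noise_level_le (hμ : 1 ≤ μ) (hS : 0 ≤ S) (hδ : 0 < δ) (hδ' : δ < 1 / 2) :
    15360 * Real.exp 1 ^ 3 * (n : ℝ) ^ 2 * tauStar n η p μ S δ * Qtot η p ^ 2 *
        Real.log (1 / δ) ≤
      15360 * Real.exp 1 ^ 3 * fTilde η p δ * (n : ℝ) ^ 2 *
        min (1 + (ratio n η p μ S δ) ^ (1 / 3 : ℝ)) T := by
  have hρ := ratio_nonneg (n := n) (η := η) (p := p) hμ hS hδ hδ'
  have hQ := Qtot_sq_mul_log_le (η := η) (p := p) (δ := δ)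
  have hf0 := fTilde_nonneg (η := η) (p := p) hδ hδ'
  have hlog := log_one_div_nonneg hδ hδ'
  rw [mul_assoc _ (Qtot η p ^ 2)]
  -- If f̃ = 0 then Q² log(1/δ) = 0 too, so both sides vanish, in line with reading the noise part
  -- of the bound as 0.
  by_cases hf : fTilde η p δ = 0
  · have : Qtot η p ^ 2 * Real.log (1 / δ) = 0 := le_antisymm (hQ.trans hf.le) (by positivity)
    rw [this, hf]; simp
  · calc _ ≤ 15360 * Real.exp 1 ^ 3 * (n : ℝ) ^ 2 *
          min (1 + (ratio n η p μ S δ) ^ (1 / 3 : ℝ)) T * fTilde η p δ := by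
          have := tauStar_le_min hρ hf
          gcongr
      _ = _ := by ring

/-- In the intermediate regime the general bound simplifies. -/
lemma generalBound_le_simpleBound {C₂ C₃ : ℝ} (hC₂ : 0 ≤ C₂) (hC₃ : 0 ≤ C₃) (hn : 1 ≤ n)
    (hT : 1 ≤ T) (hμ : 1 ≤ μ) (hf : 0 < fTilde η p δ) (hd : 0 < dBar η p) (hS : 0 < S)
    (h : 1 * max ((n * fTilde η p δ / (μ * dBar η p ^ 2 * S)) ^ (1 / 2 : ℝ))
      (μ * dBar η p ^ 2 * S / (n * fTilde η p δ)) ≤ (T : ℝ)) :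
    generalBound C₂ C₃ n η p μ S δ ≤ simpleBound (C₂ + 2 * C₃) n η p μ S δ := by
  have hn' : (0 : ℝ) < n := by exact_mod_cast hn
  have hT' : (0 : ℝ) < T := by exact_mod_cast hT
  set f := fTilde η p δ with hfdef
  set m := μ * dBar η p ^ 2 with hm
  have hm0 : 0 < m := by positivity
  rw [one_mul] at h
  have h1 := (le_max_left _ _).trans h
  have h2 := (le_max_right _ _).trans h
  set ρ := ratio n η p μ S δ with hρdef
  have hρ : ρ = m * (T : ℝ) ^ 2 * S / (n * f) := rfl
  have hρ0 : 0 < ρ := by rw [hρ]; positivity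
  have hmS : m * n * (T : ℝ) ^ 2 * S = f * (n : ℝ) ^ 2 * ρ := by rw [hρ]; field_simp
  -- The first lower bound on T is exactly ρ ≥ 1; the second gives ρ ≤ T³. Hence 1 ≤ ρ^{1/3} ≤ T,
  -- and everything below is compared with f̃ n² ρ^{1/3}.
  have hρ1 : 1 ≤ ρ := by
    rw [← Real.sqrt_eq_rpow, Real.sqrt_le_left hT'.le, div_le_iff₀ (by positivity)] at h1
    rw [hρ, le_div_iff₀ (by positivity)]
    linarith
  have hρT : ρ ≤ (T : ℝ) ^ 3 := by
    calc ρ = (m * S / (n * f)) * (T : ℝ) ^ 2 := by rw [hρ]; ring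
      _ ≤ T * (T : ℝ) ^ 2 := by gcongr
      _ = _ := by ring
  set r := ρ ^ (1 / 3 : ℝ) with hr
  have hr0 : 0 < r := Real.rpow_pos_of_pos hρ0 _
  have hr3 : r ^ 3 = ρ := by
    rw [hr, ← Real.rpow_natCast, ← Real.rpow_mul hρ0.le]; norm_num
  have hr2 : ρ ^ (2 / 3 : ℝ) = r ^ 2 := by
    rw [hr, ← Real.rpow_natCast, ← Real.rpow_mul hρ0.le]; norm_num
  have hr1 : 1 ≤ r := Real.one_le_rpow hρ1 (by norm_num)
  have hrT : r ≤ T := by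
    refine le_of_pow_le_pow_left₀ (n := 3) (by norm_num) hT'.le ?_
    rw [hr3]; exact hρT
  have hsimple : simpleBound (C₂ + 2 * C₃) n η p μ S δ =
      (C₂ + 2 * C₃) * (f * (n : ℝ) ^ 2 * r) := by
    have hr' : r = m ^ (1 / 3 : ℝ) * (T : ℝ) ^ (2 / 3 : ℝ) * S ^ (1 / 3 : ℝ) /
        ((n : ℝ) ^ (1 / 3 : ℝ) * f ^ (1 / 3 : ℝ)) := by
      rw [hr, hρ, Real.div_rpow (by positivity) (by positivity),
        Real.mul_rpow (by positivity) hS.le, Real.mul_rpow hm0.le (by positivity),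
        Real.mul_rpow hn'.le hf.le]
      have : ((T : ℝ) ^ 2) ^ (1 / 3 : ℝ) = (T : ℝ) ^ (2 / 3 : ℝ) := by
        rw [← Real.rpow_natCast, ← Real.rpow_mul hT'.le]; norm_num
      rw [this]
    have hff : f = f ^ (2 / 3 : ℝ) * f ^ (1 / 3 : ℝ) := by
      rw [← Real.rpow_add hf]; norm_num
    have hnn : (n : ℝ) ^ 2 = (n : ℝ) ^ (5 / 3 : ℝ) * (n : ℝ) ^ (1 / 3 : ℝ) := by
      rw [← Real.rpow_add hn', ← Real.rpow_natCast]; norm_num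
    have hf3 : 0 < f ^ (1 / 3 : ℝ) := Real.rpow_pos_of_pos hf _
    have hn3 : 0 < (n : ℝ) ^ (1 / 3 : ℝ) := Real.rpow_pos_of_pos hn' _
    have hprod : f * (n : ℝ) ^ 2 * r = f ^ (2 / 3 : ℝ) * m ^ (1 / 3 : ℝ) *
        (n : ℝ) ^ (5 / 3 : ℝ) * (T : ℝ) ^ (2 / 3 : ℝ) * S ^ (1 / 3 : ℝ) := by
      calc f * (n : ℝ) ^ 2 * r = (f ^ (2 / 3 : ℝ) * f ^ (1 / 3 : ℝ)) *
            ((n : ℝ) ^ (5 / 3 : ℝ) * (n : ℝ) ^ (1 / 3 : ℝ)) *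
            (m ^ (1 / 3 : ℝ) * (T : ℝ) ^ (2 / 3 : ℝ) * S ^ (1 / 3 : ℝ) /
              ((n : ℝ) ^ (1 / 3 : ℝ) * f ^ (1 / 3 : ℝ))) := by rw [← hff, ← hnn, ← hr']
        _ = _ := by field_simp
    rw [hprod]
    unfold simpleBound
    rw [← hfdef, ← hm]; ring
  have hmax : max (m * n * (T : ℝ) ^ 2 * S / (1 + ρ ^ (2 / 3 : ℝ))) (m * n * S) ≤
      f * (n : ℝ) ^ 2 * r := by
    refine max_le ?_ ?_
    · rw [hmS, hr2, div_le_iff₀ (by positivity), ← hr3]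
      have : 0 < f * (n : ℝ) ^ 2 * r := by positivity
      nlinarith
    · have : m * n * S * (T : ℝ) ^ 2 = f * (n : ℝ) ^ 2 * r * r ^ 2 := by
        rw [← hr3] at hmS; linarith
      have hT2 : r ^ 2 ≤ (T : ℝ) ^ 2 := by gcongr
      have hle : m * n * S * (T : ℝ) ^ 2 ≤ f * (n : ℝ) ^ 2 * r * (T : ℝ) ^ 2 := by
        rw [this]; gcongr
      exact le_of_mul_le_mul_right hle (by positivity)
  have hfirst : (if tauStar n η p μ S δ < T then
      C₂ * max (m * n * (T : ℝ) ^ 2 * S / (1 + ρ ^ (2 / 3 : ℝ))) (m * n * S) else 0) ≤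
      C₂ * (f * (n : ℝ) ^ 2 * r) := by
    split_ifs
    · gcongr
    · positivity
  -- 1 + r ≤ 2r because r ≥ 1; this is the 2 in C₂ + 2C₃.
  have hsecond : C₃ * f * (n : ℝ) ^ 2 * min (1 + r) T ≤ 2 * C₃ * (f * (n : ℝ) ^ 2 * r) := by
    calc C₃ * f * (n : ℝ) ^ 2 * min (1 + r) T ≤ C₃ * f * (n : ℝ) ^ 2 * (2 * r) := by
          gcongr
          exact (min_le_left _ _).trans (by linarith)
      _ = _ := by ring
  rw [hsimple]
  calc generalBound C₂ C₃ n η p μ S δ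
      ≤ C₂ * (f * (n : ℝ) ^ 2 * r) + 2 * C₃ * (f * (n : ℝ) ^ 2 * r) :=
        add_le_add hfirst hsecond
    _ = _ := by ring

end Bounds

/-- The general bound holds with probability at least `1 - δ`. -/
lemma general_bound_probability {Ω : Type*} [MeasurableSpace Ω] {P : Measure Ω}
    [IsProbabilityMeasure P] {n T : ℕ} {η : I} {p : Fin T → I} {g : Fin T → Fin n → ℂ}
    {μ S δ : ℝ} {lam : Fin T → ℝ} {v : OrthonormalBasis (Fin T) ℝ (EuclideanSpace ℝ (Fin T))}
    {H : Fin T → Ω → SimpleGraph (Fin n)} {outlier : PairIdx n T → Ω → Prop}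
    {φ : PairIdx n T → Ω → ℝ} (hT : 1 ≤ T) (hg : ∀ k i, ‖g k i‖ = 1) (hS : SignalSmooth g S)
    (hv : IsSortedEigenbasis lam v) (hμ : 1 ≤ μ) (hD : DSmooth v g η p μ)
    (hM : IsOutliersModel P η p H outlier φ) (hδ : 0 < δ) (hδ' : δ < 1 / 2) :
    1 - δ ≤ P.real {ω | sqError v g η p μ S δ H outlier φ ω ≤
      generalBound 32 (15360 * Real.exp 1 ^ 3) n η p μ S δ} := by
  set G := {ω | sqError v g η p μ S δ H outlier φ ω ≤
      generalBound 32 (15360 * Real.exp 1 ^ 3) n η p μ S δ} with hG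
  have hsub : Gᶜ ⊆ {ω | 15360 * Real.exp 1 ^ 3 * (n : ℝ) ^ 2 * tauStar n η p μ S δ *
      Qtot η p ^ 2 * Real.log (1 / δ) <
        noiseSq v g η p H outlier φ (tauStar n η p μ S δ) ω} := by
    intro ω hω
    by_contra hcon
    refine hω ?_
    rw [Set.mem_ofPred_eq, not_lt] at hcon
    have hdec : sqError v g η p μ S δ H outlier φ ω =
        noiseSq v g η p H outlier φ (tauStar n η p μ S δ) ω +
          frobSq ((1 - proj v (tauStar n η p μ S δ) n) * (Dmat n η p * Gbar g)) :=
      frobSq_proj_mul_sub v _ _ _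
    change sqError v g η p μ S δ H outlier φ ω ≤ _
    rw [hdec, add_comm]
    exact add_le_add (bias_le hT hg hS hv hμ hD hδ hδ')
      (hcon.trans (noise_level_le hμ hS.nonneg hδ hδ'))
  have h1 := (measureReal_mono hsub (μ := P)).trans
    (noiseSq_tail v hM hg hδ hδ' (tauStar n η p μ S δ))
  -- Subadditivity gives 1 ≤ P(G) + P(Gᶜ) without measurability of G.
  have h2 := measureReal_union_le (μ := P) G Gᶜ
  rw [Set.union_compl_self, probReal_univ] at h2
  linarith

end DynSync

/-! ### The main theorem with explicit constants. -/

open DynSync in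
theorem mainTheorem2 :
    ∃ C₁ C₂ C₃ C₄ C₅ : ℝ,
      0 < C₁ ∧ C₁ < 1 ∧ 0 < C₂ ∧ 0 < C₃ ∧ 0 < C₄ ∧ 0 < C₅ ∧
      ∀ (n T : ℕ), 1 ≤ n → 1 ≤ T →
      ∀ (g : Fin T → Fin n → ℂ), (∀ k i, ‖g k i‖ = 1) →
      ∀ (S : ℝ), SignalSmooth g S →
      ∀ (lam : Fin T → ℝ) (v : OrthonormalBasis (Fin T) ℝ (EuclideanSpace ℝ (Fin T))),
        IsSortedEigenbasis lam v →
      ∀ (η : unitInterval) (p : Fin T → unitInterval) (μ : ℝ), 1 ≤ μ → DSmooth v g η p μ →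
      ∀ (Ω : Type*) [MeasurableSpace Ω] (P : MeasureTheory.Measure Ω)
        [MeasureTheory.IsProbabilityMeasure P]
        (H : Fin T → Ω → SimpleGraph (Fin n)) (outlier : PairIdx n T → Ω → Prop)
        (φ : PairIdx n T → Ω → ℝ), IsOutliersModel P η p H outlier φ →
      ∀ (δ : ℝ), 0 < δ → δ < C₁ →
        (1 - δ ≤ P.real {ω | sqError v g η p μ S δ H outlier φ ω ≤
            generalBound C₂ C₃ n η p μ S δ}) ∧
        (0 < fTilde η p δ → 0 < dBar η p → 0 < S →
          C₄ * max ((n * fTilde η p δ / (μ * dBar η p ^ 2 * S)) ^ (1 / 2 : ℝ))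
            (μ * dBar η p ^ 2 * S / (n * fTilde η p δ)) ≤ (T : ℝ) →
          (∀ ω, sqError v g η p μ S δ H outlier φ ω ≤ generalBound C₂ C₃ n η p μ S δ →
            sqError v g η p μ S δ H outlier φ ω ≤ simpleBound C₅ n η p μ S δ) ∧
          1 - δ ≤ P.real {ω | sqError v g η p μ S δ H outlier φ ω ≤
            simpleBound C₅ n η p μ S δ}) := by
  refine ⟨1 / 2, 32, 15360 * Real.exp 1 ^ 3, 1, 32 + 2 * (15360 * Real.exp 1 ^ 3), by norm_num,
    by norm_num, by norm_num, by positivity, by norm_num, by positivity, ?_⟩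
  intro n T hn hT g hg S hS lam v hv η p μ hμ hD Ω _ P _ H outlier φ hM δ hδ hδ'
  have hgen := general_bound_probability hT hg hS hv hμ hD hM hδ hδ'
  refine ⟨hgen, fun hf hd hS0 hreg => ?_⟩
  have hle := generalBound_le_simpleBound (C₂ := 32) (C₃ := 15360 * Real.exp 1 ^ 3) (by norm_num)
    (by positivity) hn hT hμ hf hd hS0 hreg
  exact ⟨fun ω hω => hω.trans hle,
    hgen.trans (measureReal_mono fun ω hω => le_trans (show _ ≤ _ from hω) hle)⟩
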